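/- Let $\lambda\in\mathbb R$ and consider, for positive functions $f_1,\dots,f_5$ of $t$, the Model E Einstein system \begin{align*} &\tfrac{f_1''}{f_1}-\tfrac{24}{f_1^2}-2\Big(\tfrac{f_1^2}{f_2^4}+\tfrac{f_1^2}{f_3^4}+6\tfrac{f_1^2}{f_4^2f_5^2}-6\tfrac{f_4^2}{f_1^2f_5^2}-6\tfrac{f_5^2}{f_1^2f_4^2}\Big)+8\tfrac{f_1'f_2'}{f_1f_2}+8\tfrac{f_1'f_3'}{f_1f_3}+6\tfrac{f_1'f_4'}{f_1f_4}+6\tfrac{f_1'f_5'}{f_1f_5}=-\lambda,\\ &\tfrac{f_i''}{f_i}-\tfrac{32}{f_i^2}-3\Big(\tfrac{f_i^2}{f_j^2f_4^2}-\tfrac{f_j^2}{f_i^2f_4^2}-\tfrac{f_4^2}{f_i^2f_j^2}+\tfrac{f_i^2}{f_j^2f_5^2}-\tfrac{f_j^2}{f_i^2f_5^2}-\tfrac{f_5^2}{f_i^2f_j^2}-\tfrac16\tfrac{f_1^2}{f_i^4}\Big)+7\tfrac{f_i'^2}{f_i^2}+\tfrac{f_1'f_i'}{f_1f_i}+8\tfrac{f_2'f_3'}{f_2f_3}+6\tfrac{f_i'f_4'}{f_if_4}+6\tfrac{f_i'f_5'}{f_if_5}=-\lambda,\quad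 \{i,j\}=\{2,3\},\\ &\tfrac{f_i''}{f_i}-\tfrac{32}{f_i^2}-4\Big(\tfrac{f_i^2}{f_2^2f_3^2}-\tfrac{f_2^2}{f_i^2f_3^2}-\tfrac{f_3^2}{f_i^2f_2^2}+\tfrac12\tfrac{f_i^2}{f_1^2f_j^2}-\tfrac12\tfrac{f_1^2}{f_i^2f_j^2}-\tfrac12\tfrac{f_j^2}{f_i^2f_1^2}\Big)+5\tfrac{f_i'^2}{f_i^2}+\tfrac{f_1'f_i'}{f_1f_i}+8\tfrac{f_2'f_i'}{f_2f_i}+8\tfrac{f_3'f_i'}{f_3f_i}+6\tfrac{f_4'f_5'}{f_4f_5}=-\lambda,\quad \{i,j\}=\{4,5\}. \end{align*} The smoothness conditions at the singular orbit $t=0$, for $\zeta_0>0$, are $$f(0)=(0,0,\zeta_0,\zeta_0,\zeta_0),\quad f'(0)=(4,\sqrt2,0,0,0),\quad f_1''(0)=f_2''(0)=0,$$ and those at the singular orbit $t=1$, for $\zeta_1,\xi_1>0$, are $$f(1)=(\zeta_1,\xi_1,\xi_1,0,\zeta_1),\quad f'(1)=(0,0,0,-2,0),\quad f_4''(1)=0.$$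 A solution near $t=0$ (near $t=1$) is a function $f=(f_1,\dots,f_5)$ that is real-analytic on some $[0,\epsilon)$ (on some $(1-\epsilon,1]$), including the closed end, is componentwise positive and satisfies the system in the interior, and satisfies the respective smoothness conditions at the closed end, where derivatives are one-sided. Solutions that agree near the closed end are identified. Put $\tau=t$ and $x=(f_1^2/\tau^2,f_2^2/\tau^2,f_3^2,f_4^2,f_5^2)$ near $t=0$, and $\tau=1-t$ and $x=(f_1^2,f_2^2,f_3^2,f_4^2/\tau^2,f_5^2)$ near $t=1$, and let $y=\frac12\frac{dx}{d\tau}$. The system then reads $x'=2y$, $y'=\tau^{-2}A(x)+\tau^{-1}B(x,y)+C(\tau,x,y)$ (a prime denotes $d/d\tau$), where $A,B,C$ are explicit and analytic near the initial point $(\tau,x,y)=(0,x_0,0)$, with $x_0=(16,2,\zeta_0^2,\zeta_0^2,\zeta_0^2)$ and $x_0=(\zeta_1^2,\xi_1^2,\xi_1^2,4,\zeta_1^2)$ respectively. Let $\mathcal L_0=\mathrm{Id}-(dA)_{x_0}-(\partial_yB)_{(x_0,0)}$. Then: a) For all $\lambda\in\mathbb R$ and $\zeta_0>0$ there are infinitely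 many solutions near $t=0$. The kernel of $\mathcal L_0$ is two-dimensional and parametrizes them: there is a bijection from $\ker\mathcal L_0$ onto the set of solutions near $t=0$ such that the solution corresponding to $k$ satisfies $x=x_0+\frac{t^2}{2}(p+k)+o(t^2)$ as $t\to0^+$, where $p=\big(\frac{32\lambda\zeta_0^2-2048}{3\zeta_0^2},0,16-\frac{\lambda\zeta_0^2}2,0,0\big)$. b) For all $\lambda\in\mathbb R$ and $\zeta_1,\xi_1>0$ there are infinitely many solutions near $t=1$. The kernel of the corresponding operator $\mathcal L_0$ is one-dimensional and parametrizes them: there are $p\in\mathbb R^5$ and a bijection from $\ker\mathcal L_0$ onto the set of solutions near $t=1$ such that the solution corresponding to $k$ satisfies $x=x_0+\frac{(1-t)^2}{2}(p+k)+o((1-t)^2)$ as $t\to1^-$. -/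

import Mathlib

open Filter Topology Set Asymptotics

noncomputable section

/-- Values of the five metric functions `(f₁, …, f₅)`; the function `fᵢ` has index `i - 1 : Fin 5`. -/
abbrev Vec5 : Type := Fin 5 → ℝ

/-- The five Einstein equations of Model E with Einstein constant `lam`, at one time,
where `u`, `v`, `w` are the values of `f`, `f'`, `f''` there. -/
def EinsteinE (lam : ℝ) (u v w : Vec5) : Prop :=
  (w 0 / u 0 - 24 / u 0 ^ 2
      - 2 * (u 0 ^ 2 / u 1 ^ 4 + u 0 ^ 2 / u 2 ^ 4 + 6 * (u 0 ^ 2 / (u 3 ^ 2 * u 4 ^ 2))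
        - 6 * (u 3 ^ 2 / (u 0 ^ 2 * u 4 ^ 2)) - 6 * (u 4 ^ 2 / (u 0 ^ 2 * u 3 ^ 2)))
      + 8 * (v 0 * v 1 / (u 0 * u 1)) + 8 * (v 0 * v 2 / (u 0 * u 2))
      + 6 * (v 0 * v 3 / (u 0 * u 3)) + 6 * (v 0 * v 4 / (u 0 * u 4)) = -lam) ∧
  (w 1 / u 1 - 32 / u 1 ^ 2
      - 3 * (u 1 ^ 2 / (u 2 ^ 2 * u 3 ^ 2) - u 2 ^ 2 / (u 1 ^ 2 * u 3 ^ 2)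
        - u 3 ^ 2 / (u 1 ^ 2 * u 2 ^ 2) + u 1 ^ 2 / (u 2 ^ 2 * u 4 ^ 2)
        - u 2 ^ 2 / (u 1 ^ 2 * u 4 ^ 2) - u 4 ^ 2 / (u 1 ^ 2 * u 2 ^ 2)
        - 1 / 6 * (u 0 ^ 2 / u 1 ^ 4))
      + 7 * (v 1 ^ 2 / u 1 ^ 2) + v 0 * v 1 / (u 0 * u 1)
      + 8 * (v 1 * v 2 / (u 1 * u 2)) + 6 * (v 1 * v 3 / (u 1 * u 3))
      + 6 * (v 1 * v 4 / (u 1 * u 4)) = -lam) ∧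
  (w 2 / u 2 - 32 / u 2 ^ 2
      - 3 * (u 2 ^ 2 / (u 1 ^ 2 * u 3 ^ 2) - u 1 ^ 2 / (u 2 ^ 2 * u 3 ^ 2)
        - u 3 ^ 2 / (u 2 ^ 2 * u 1 ^ 2) + u 2 ^ 2 / (u 1 ^ 2 * u 4 ^ 2)
        - u 1 ^ 2 / (u 2 ^ 2 * u 4 ^ 2) - u 4 ^ 2 / (u 2 ^ 2 * u 1 ^ 2)
        - 1 / 6 * (u 0 ^ 2 / u 2 ^ 4))
      + 7 * (v 2 ^ 2 / u 2 ^ 2) + v 0 * v 2 / (u 0 * u 2)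
      + 8 * (v 1 * v 2 / (u 1 * u 2)) + 6 * (v 2 * v 3 / (u 2 * u 3))
      + 6 * (v 2 * v 4 / (u 2 * u 4)) = -lam) ∧
  (w 3 / u 3 - 32 / u 3 ^ 2
      - 4 * (u 3 ^ 2 / (u 1 ^ 2 * u 2 ^ 2) - u 1 ^ 2 / (u 3 ^ 2 * u 2 ^ 2)
        - u 2 ^ 2 / (u 3 ^ 2 * u 1 ^ 2) + 1 / 2 * (u 3 ^ 2 / (u 0 ^ 2 * u 4 ^ 2))
        - 1 / 2 * (u 0 ^ 2 / (u 3 ^ 2 * u 4 ^ 2)) - 1 / 2 * (u 4 ^ 2 / (u 3 ^ 2 * u 0 ^ 2)))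
      + 5 * (v 3 ^ 2 / u 3 ^ 2) + v 0 * v 3 / (u 0 * u 3)
      + 8 * (v 1 * v 3 / (u 1 * u 3)) + 8 * (v 2 * v 3 / (u 2 * u 3))
      + 6 * (v 3 * v 4 / (u 3 * u 4)) = -lam) ∧
  (w 4 / u 4 - 32 / u 4 ^ 2
      - 4 * (u 4 ^ 2 / (u 1 ^ 2 * u 2 ^ 2) - u 1 ^ 2 / (u 4 ^ 2 * u 2 ^ 2)
        - u 2 ^ 2 / (u 4 ^ 2 * u 1 ^ 2) + 1 / 2 * (u 4 ^ 2 / (u 0 ^ 2 * u 3 ^ 2))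
        - 1 / 2 * (u 0 ^ 2 / (u 4 ^ 2 * u 3 ^ 2)) - 1 / 2 * (u 3 ^ 2 / (u 4 ^ 2 * u 0 ^ 2)))
      + 5 * (v 4 ^ 2 / u 4 ^ 2) + v 0 * v 4 / (u 0 * u 4)
      + 8 * (v 1 * v 4 / (u 1 * u 4)) + 8 * (v 2 * v 4 / (u 2 * u 4))
      + 6 * (v 3 * v 4 / (u 3 * u 4)) = -lam)

/-- `f` is a solution of the Einstein system on the interval `s` (half-open, with the singular
orbit at its closed end): real-analytic on `s` including the closed end, with all `fᵢ > 0` and the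
five equations in the interior. -/
def IsSolutionOnE (lam : ℝ) (f : ℝ → Vec5) (s : Set ℝ) : Prop :=
  AnalyticOn ℝ f s ∧
    ∀ t ∈ interior s, (∀ i, 0 < f t i) ∧ EinsteinE lam (f t) (deriv f t) (deriv (deriv f) t)

/-- Smoothness conditions at `t = 0` (derivatives are one-sided, taken within `s = [0, ε)`). -/
def InitialConditionsE (ζ : ℝ) (f : ℝ → Vec5) (s : Set ℝ) : Prop :=
  f 0 = ![0, 0, ζ, ζ, ζ] ∧
    derivWithin f s 0 = ![4, Real.sqrt 2, 0, 0, 0] ∧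
    iteratedDerivWithin 2 f s 0 0 = 0 ∧ iteratedDerivWithin 2 f s 0 1 = 0

/-- Smoothness conditions at `t = 1` (derivatives are one-sided, taken within `s = (1 - ε, 1]`).
The slope `f₄'(1) = -2` is minus the factor `c > 0` for which `c² (·,·)` restricted to `𝔪₄` is
the round metric of curvature one on `K₁ / H = S⁶`. -/
def FinalConditionsE (ζ ξ : ℝ) (f : ℝ → Vec5) (s : Set ℝ) : Prop :=
  f 1 = ![ζ, ξ, ξ, 0, ζ] ∧
    derivWithin f s 1 = ![0, 0, 0, -2, 0] ∧
    iteratedDerivWithin 2 f s 1 3 = 0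

/-- Germs at `0` of the solutions defined on some `[0, ε)` with the initial conditions. -/
def initialGermsE (lam ζ : ℝ) : Set (Germ (𝓝[≥] (0 : ℝ)) Vec5) :=
  {g | ∃ ε > 0, ∃ f : ℝ → Vec5, IsSolutionOnE lam f (Ico 0 ε) ∧
    InitialConditionsE ζ f (Ico 0 ε) ∧ (f : Germ (𝓝[≥] (0 : ℝ)) Vec5) = g}

/-- Germs at `1` of the solutions defined on some `(1 - ε, 1]` with the final conditions. -/
def finalGermsE (lam ζ ξ : ℝ) : Set (Germ (𝓝[≤] (1 : ℝ)) Vec5) :=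
  {g | ∃ ε > 0, ∃ f : ℝ → Vec5, IsSolutionOnE lam f (Ioc (1 - ε) 1) ∧
    FinalConditionsE ζ ξ f (Ioc (1 - ε) 1) ∧ (f : Germ (𝓝[≤] (1 : ℝ)) Vec5) = g}

/-- The operator `𝓛ₘ = (m + 1) Id - 2 / (m + 2) (dA)_{x₀} - (∂_y B)_{(x₀, 0)}` of a singular
system `x' = 2 y`, `y' = A(x) / t² + B(x, y) / t + C(t, x, y)` with `x(0) = x₀`, `y(0) = 0`. -/
def recursionOp (A : Vec5 → Vec5) (B : Vec5 → Vec5 → Vec5) (x₀ : Vec5) (m : ℕ) :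
    Vec5 →L[ℝ] Vec5 :=
  ((m : ℝ) + 1) • ContinuousLinearMap.id ℝ Vec5 - (2 / ((m : ℝ) + 2)) • fderiv ℝ A x₀
    - fderiv ℝ (B x₀) 0

/-! Near `t = 0`: `x₁ = f₁² / t²`, `x₂ = f₂² / t²`, `xᵢ = fᵢ²` otherwise, `y = x' / 2`. -/

def xVarZero (f : ℝ → Vec5) (t : ℝ) : Vec5 :=
  ![f t 0 ^ 2 / t ^ 2, f t 1 ^ 2 / t ^ 2, f t 2 ^ 2, f t 3 ^ 2, f t 4 ^ 2]

def xInitE (ζ : ℝ) : Vec5 := ![16, 2, ζ ^ 2, ζ ^ 2, ζ ^ 2]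

def coeffAZero (x : Vec5) : Vec5 :=
  ![24 + 2 * (x 0 ^ 2 / x 1 ^ 2) - 8 * x 0 - 12 * (x 3 / x 4) - 12 * (x 4 / x 3),
    32 - 8 * x 1 - 1 / 2 * (x 0 / x 1) - 3 * (x 2 / x 3) - 3 * (x 3 / x 2)
      - 3 * (x 2 / x 4) - 3 * (x 4 / x 2),
    3 * (x 2 ^ 2 / (x 1 * x 3)) + 3 * (x 2 ^ 2 / (x 1 * x 4)) - 3 * (x 3 / x 1) - 3 * (x 4 / x 1),
    4 * (x 3 ^ 2 / (x 1 * x 2)) + 2 * (x 3 ^ 2 / (x 0 * x 4)) - 4 * (x 2 / x 1) - 2 * (x 4 / x 0),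
    4 * (x 4 ^ 2 / (x 1 * x 2)) + 2 * (x 4 ^ 2 / (x 0 * x 3)) - 4 * (x 2 / x 1) - 2 * (x 3 / x 0)]

def coeffBZero (x y : Vec5) : Vec5 :=
  ![-10 * y 0 - 8 * (x 0 * y 1 / x 1) - 8 * (x 0 * y 2 / x 2) - 6 * (x 0 * y 3 / x 3)
      - 6 * (x 0 * y 4 / x 4),
    -17 * y 1 - x 1 * y 0 / x 0 - 8 * (x 1 * y 2 / x 2) - 6 * (x 1 * y 3 / x 3)
      - 6 * (x 1 * y 4 / x 4),
    -9 * y 2, -9 * y 3, -9 * y 4]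

/-- The kernel of `𝓛₀` at the singular orbit `Q₀`. -/
def kernelZero (ζ : ℝ) : Submodule ℝ Vec5 :=
  LinearMap.ker (recursionOp coeffAZero coeffBZero (xInitE ζ) 0 : Vec5 →ₗ[ℝ] Vec5)

/-- The particular solution of `𝓛₀(x²) = D₀` at `Q₀`. -/
def particularZero (lam ζ : ℝ) : Vec5 :=
  ![(32 * lam * ζ ^ 2 - 2048) / (3 * ζ ^ 2), 0, 16 - lam * ζ ^ 2 / 2, 0, 0]

/-! Near `t = 1`, in the time `1 - t`: `x₄ = f₄² / (1 - t)²`, `xᵢ = fᵢ²` otherwise. -/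

def xVarOne (f : ℝ → Vec5) (t : ℝ) : Vec5 :=
  ![f t 0 ^ 2, f t 1 ^ 2, f t 2 ^ 2, f t 3 ^ 2 / (1 - t) ^ 2, f t 4 ^ 2]

def xFinalE (ζ ξ : ℝ) : Vec5 := ![ζ ^ 2, ξ ^ 2, ξ ^ 2, 4, ζ ^ 2]

def coeffAOne (x : Vec5) : Vec5 :=
  ![12 * (x 0 ^ 2 / (x 3 * x 4)) - 12 * (x 4 / x 3),
    3 * (x 1 ^ 2 / (x 2 * x 3)) - 3 * (x 2 / x 3),
    3 * (x 2 ^ 2 / (x 1 * x 3)) - 3 * (x 1 / x 3),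
    32 - 5 * x 3 - 4 * (x 1 / x 2) - 4 * (x 2 / x 1) - 2 * (x 0 / x 4) - 2 * (x 4 / x 0),
    2 * (x 4 ^ 2 / (x 0 * x 3)) - 2 * (x 0 / x 3)]

def coeffBOne (x y : Vec5) : Vec5 :=
  ![-6 * y 0, -6 * y 1, -6 * y 2,
    -12 * y 3 - x 3 * y 0 / x 0 - 8 * (x 3 * y 1 / x 1) - 8 * (x 3 * y 2 / x 2)
      - 6 * (x 3 * y 4 / x 4),
    -6 * y 4]

/-- The kernel of `𝓛₀` at the singular orbit `Q₁`. -/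
def kernelOne (ζ ξ : ℝ) : Submodule ℝ Vec5 :=
  LinearMap.ker (recursionOp coeffAOne coeffBOne (xFinalE ζ ξ) 0 : Vec5 →ₗ[ℝ] Vec5)

end

/-! Near a singular orbit write `f_i = t ^ ε_i * exp φ_i`, where `ε_i` is 1 for the functions that
vanish there and 0 for the others. After multiplication by `t ^ 2`, the equations for `V_i = t φ_i'`
and the curvature monomials `Mₐ = exp (∑ γ_{aj} φ_j)` form a Fuchsian system that is at most
quadratic. The smoothness conditions say exactly that `φ_i(0)` is the logarithm of the prescribed
value or slope and that `φ_i'(0) = 0`, so `V` has no term of order one. Comparison of coefficients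
gives, in order `m`, a linear equation `indicial m (V_m) =` (lower orders). In order two it reads
`indicial 2 q = source`. This has an explicit solution, so its solution set is an affine space over
the kernel. For `m ≥ 3` the operator is invertible (`eq_zero_of_indicial_zero`,
`eq_zero_of_indicial_one`), so `q` determines a unique formal solution (`exists_coeff_seq`,
`coeff_seq_unique`). The series converges because `m` times the size of the `m`-th coefficients is
bounded by the coefficients themselves, their convolution square and their partial sums
(`exists_coeff_bound`, `exists_geometric_bound`). Since `x_i = c_i ^ 2 * (1 + q_i t ^ 2) + o(t ^
2)`, the operators `𝓛₀` and `indicial 2` differ only by diagonal rescalings (`recursionOp_zero`,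
`recursionOp_one`). The kernel of `𝓛₀` therefore parametrizes the solutions. The orbit at `t = 1` is
treated by reversing time, under which the equations are invariant. -/

noncomputable section

/-! ### Convergent power series at the origin -/

/-- The power series `p` converges to `g` near `0`. -/
def HasExpansion (g : ℝ → ℝ) (p : PowerSeries ℝ) : Prop :=
  ∀ᶠ t in 𝓝 (0 : ℝ), HasSum (fun n => t ^ n * PowerSeries.coeff n p) (g t)

namespace HasExpansion

open PowerSeries

variable {g h : ℝ → ℝ} {p q : PowerSeries ℝ}

lemma iff_hasFPowerSeriesAt :
    HasExpansion g p ↔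
      HasFPowerSeriesAt g (FormalMultilinearSeries.ofScalars ℝ fun n => coeff n p) 0 := by
  rw [hasFPowerSeriesAt_iff]
  simp [HasExpansion, FormalMultilinearSeries.coeff_ofScalars]

lemma analyticAt (hg : HasExpansion g p) : AnalyticAt ℝ g 0 :=
  (iff_hasFPowerSeriesAt.1 hg).analyticAt

lemma exists_of_analyticAt (hg : AnalyticAt ℝ g 0) : ∃ p, HasExpansion g p := by
  obtain ⟨s, hs⟩ := hg
  refine ⟨PowerSeries.mk s.coeff, ?_⟩
  rw [hasFPowerSeriesAt_iff] at hs
  simpa [HasExpansion] using hs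

lemma congr (hg : HasExpansion g p) (e : g =ᶠ[𝓝 0] h) : HasExpansion h p := by
  filter_upwards [hg, e] with t ht e
  rwa [← e]

/-- Agreement for small `t > 0` suffices by the identity theorem for analytic functions. This turns
equations known only in the interior into identities of formal series. -/
lemma unique (hg : HasExpansion g p) (hh : HasExpansion h q) (e : g =ᶠ[𝓝[>] 0] h) : p = q := by
  have e' : g =ᶠ[𝓝 0] h := by
    refine (hg.analyticAt.frequently_eq_iff_eventually_eq hh.analyticAt).1 ?_
    exact (e.frequently).filter_mono (nhdsWithin_mono _ fun x hx => ne_of_gt hx)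
  have h1 := iff_hasFPowerSeriesAt.1 (hg.congr e')
  have h2 := iff_hasFPowerSeriesAt.1 hh
  have := h1.eq_formalMultilinearSeries h2
  ext n
  simpa [FormalMultilinearSeries.coeff_ofScalars] using
    congrArg (fun s => FormalMultilinearSeries.coeff s n) this

lemma eventuallyEq (hg : HasExpansion g p) (hh : HasExpansion h p) : g =ᶠ[𝓝 0] h := by
  filter_upwards [hg, hh] with t h1 h2 using h1.unique h2

lemma add (hg : HasExpansion g p) (hh : HasExpansion h q) :
    HasExpansion (fun t => g t + h t) (p + q) := by
  filter_upwards [hg, hh] with t h1 h2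
  simpa [mul_add] using h1.add h2

lemma const (c : ℝ) : HasExpansion (fun _ => c) (C c) := by
  refine Eventually.of_forall fun t => ?_
  convert hasSum_single (f := fun n => t ^ n * coeff n (C c)) 0 ?_ using 1
  · simp
  · intro n hn
    simp [coeff_C, hn]

lemma pow (k : ℕ) : HasExpansion (fun t => t ^ k) (X ^ k) := by
  refine Eventually.of_forall fun t => ?_
  convert hasSum_single (f := fun n => t ^ n * coeff n ((X : PowerSeries ℝ) ^ k)) k ?_ using 1
  · simp
  · intro n hn
    simp [coeff_X_pow, hn]

lemma mul (hg : HasExpansion g p) (hh : HasExpansion h q) :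
    HasExpansion (fun t => g t * h t) (p * q) := by
  filter_upwards [hg, hh] with t h1 h2
  have s1 := h1.summable.norm
  have s2 := h2.summable.norm
  have key : (fun n => t ^ n * coeff n (p * q)) = fun n => ∑ kl ∈ Finset.HasAntidiagonal.antidiagonal n,
      (t ^ kl.1 * coeff kl.1 p) * (t ^ kl.2 * coeff kl.2 q) := by
    funext n
    rw [coeff_mul, Finset.mul_sum]
    refine Finset.sum_congr rfl fun kl hkl => ?_
    rw [← Finset.HasAntidiagonal.mem_antidiagonal.1 hkl, pow_add]
    ring
  rw [← h1.tsum_eq, ← h2.tsum_eq, tsum_mul_tsum_eq_tsum_sum_antidiagonal_of_summable_norm s1 s2,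
    key]
  exact (summable_norm_sum_mul_antidiagonal_of_summable_norm s1 s2).of_norm.hasSum

lemma sum {ι : Type*} (s : Finset ι) {g : ι → ℝ → ℝ} {p : ι → PowerSeries ℝ}
    (hg : ∀ i ∈ s, HasExpansion (g i) (p i)) :
    HasExpansion (fun t => ∑ i ∈ s, g i t) (∑ i ∈ s, p i) := by
  filter_upwards [(Filter.eventually_all_finset s).2 hg] with t ht
  simpa [Finset.mul_sum] using hasSum_sum ht

lemma derivative (hg : HasExpansion g p) : HasExpansion (deriv g) (d⁄dX ℝ p) := by
  obtain ⟨r, hr⟩ := iff_hasFPowerSeriesAt.1 hg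
  have := (hr.fderiv.hasFPowerSeriesAt)
  rw [hasFPowerSeriesAt_iff] at this
  filter_upwards [this] with t ht
  have h2 := (ContinuousLinearMap.apply ℝ ℝ (1 : ℝ)).hasSum ht
  simp only [zero_add, map_smul, ContinuousLinearMap.apply_apply,
    fderiv_apply_one_eq_deriv] at h2
  refine (congrArg (fun s => HasSum s (deriv g t)) (funext fun n => ?_)).mp h2
  rw [coeff_derivative, FormalMultilinearSeries.derivSeries_coeff_one,
    FormalMultilinearSeries.coeff_ofScalars]
  simp [mul_comm]

lemma eval_zero (hg : HasExpansion g p) : constantCoeff p = g 0 := by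
  have := hg.self_of_nhds
  have h2 := hasSum_single (f := fun n => (0 : ℝ) ^ n * coeff n p) 0
    (fun n hn => by simp [hn])
  simpa using h2.unique this

lemma of_coeff_bound {a R : ℝ} (hp : ∀ n, |coeff n p| ≤ a * R ^ n) :
    HasExpansion (fun t => ∑' n, t ^ n * coeff n p) p := by
  have : ∀ᶠ t in 𝓝 (0 : ℝ), |t * R| < 1 := by
    have : Tendsto (fun t : ℝ => |t * R|) (𝓝 0) (𝓝 |0 * R|) := by
      apply Continuous.tendsto
      fun_prop
    exact this.eventually_lt_const (by simp)
  filter_upwards [this] with t ht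
  refine Summable.hasSum (Summable.of_norm_bounded
    ((summable_geometric_of_lt_one (abs_nonneg _) ht).mul_left a) fun n => ?_)
  rw [Real.norm_eq_abs, abs_mul, abs_pow, abs_mul, mul_pow]
  calc |t| ^ n * |coeff n p| ≤ |t| ^ n * |a * R ^ n| := by
        exact mul_le_mul_of_nonneg_left ((hp n).trans (le_abs_self _)) (by positivity)
    _ ≤ a * (|t| ^ n * |R| ^ n) := by
        have ha : 0 ≤ a := by simpa using (abs_nonneg (coeff 0 p)).trans (hp 0)
        rw [abs_mul, abs_pow, abs_of_nonneg ha]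
        apply le_of_eq
        ring

end HasExpansion

/-! ### Geometric growth from quadratic recursive inequalities -/

/-- Sequences dominated, up to a constant and finitely many terms, by the convolution square and
the lower partial sums of `n`. -/
def QuadraticallyDominated (n : ℕ → ℝ) (b : ℕ → ℝ) : Prop :=
  ∃ K ≥ 0, ∃ m₀, ∀ m ≥ m₀, |b m| ≤ K * (n m + ∑ j ∈ Finset.range m, n j * n (m - j) +
    ∑ j ∈ Finset.range m, n j)

namespace QuadraticallyDominated

variable {n b b' : ℕ → ℝ}

lemma add (hb : QuadraticallyDominated n b) (hb' : QuadraticallyDominated n b') :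
    QuadraticallyDominated n (b + b') := by
  obtain ⟨K, hK, m₀, h⟩ := hb
  obtain ⟨K', hK', m₀', h'⟩ := hb'
  refine ⟨K + K', by positivity, max m₀ m₀', fun m hm => ?_⟩
  have h1 := h m (le_trans (le_max_left _ _) hm)
  have h2 := h' m (le_trans (le_max_right _ _) hm)
  rw [add_mul]
  exact (abs_add_le _ _).trans (add_le_add h1 h2)

lemma of_eventually_zero (m₀ : ℕ) (h : ∀ m ≥ m₀, b m = 0) :
    QuadraticallyDominated n b := by
  refine ⟨0, le_rfl, m₀, fun m hm => ?_⟩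
  simp [h m hm]

lemma smul (hb : QuadraticallyDominated n b) (c : ℝ) : QuadraticallyDominated n (c • b) := by
  obtain ⟨K, hK, m₀, h⟩ := hb
  refine ⟨|c| * K, by positivity, m₀, fun m hm => ?_⟩
  rw [Pi.smul_apply, smul_eq_mul, abs_mul, mul_assoc]
  exact mul_le_mul_of_nonneg_left (h m hm) (abs_nonneg c)

lemma sum {ι : Type*} (s : Finset ι) {b : ι → ℕ → ℝ}
    (hb : ∀ i ∈ s, QuadraticallyDominated n (b i)) :
    QuadraticallyDominated n (∑ i ∈ s, b i) := by
  classical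
  induction s using Finset.induction_on with
  | empty => exact of_eventually_zero 0 (by simp)
  | insert i s hi ih =>
    rw [Finset.sum_insert hi]
    exact (hb i (by simp)).add (ih fun j hj => hb j (by simp [hj]))

end QuadraticallyDominated

/-- A sequence with `m n_m` bounded by `n_m`, its convolution square and its partial sums
grows at most geometrically. -/
lemma exists_geometric_bound {n : ℕ → ℝ} (hn : ∀ m, 0 ≤ n m) (h0 : n 0 = 0)
    (h : QuadraticallyDominated n fun m => m * n m) : ∃ a R : ℝ, ∀ m, n m ≤ a * R ^ m := by
  obtain ⟨K', hK', m₀, h⟩ := h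
  obtain ⟨K, hK, hKK⟩ : ∃ K : ℝ, 0 < K ∧ K' ≤ K := ⟨K' + 1, by positivity, by linarith⟩
  -- Induction on `n m ≤ a * R ^ m`. For `m ≥ N` we have `K ≤ m / 2`, so `K * n m` is absorbed on
  -- the left. With `K * a = 1 / 4` and `R ≥ 4 * K`, the convolution and the partial sum each
  -- contribute at most `m * a * R ^ m / 4`. The sum in `R` takes care of the indices below `N`.
  set N : ℕ := max m₀ (⌈2 * K⌉₊ + 1) with hN
  set a : ℝ := 1 / (4 * K) with ha
  have ha0 : 0 < a := by positivity
  set R : ℝ := 4 * K + 1 + ∑ j ∈ Finset.range N, n j / a with hR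
  have hsum : 0 ≤ ∑ j ∈ Finset.range N, n j / a :=
    Finset.sum_nonneg fun j _ => div_nonneg (hn j) ha0.le
  have hR1 : 1 ≤ R := by linarith
  have hRK : 4 * K ≤ R := by linarith
  refine ⟨a, R, fun m => ?_⟩
  induction m using Nat.strong_induction_on with
  | _ m ih =>
    rcases Nat.eq_zero_or_pos m with rfl | hm
    · simpa [h0] using ha0.le
    rcases lt_or_ge m N with hmN | hmN
    · have : n m / a ≤ R := by
        have := Finset.single_le_sum (f := fun j => n j / a)
          (fun j _ => div_nonneg (hn j) ha0.le) (Finset.mem_range.2 hmN)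
        linarith
      rw [div_le_iff₀ ha0] at this
      calc n m ≤ R * a := this
        _ = a * R ^ 1 := by ring
        _ ≤ a * R ^ m := by gcongr; exacts [hm]
    · have hm0 : m₀ ≤ m := le_trans (le_max_left _ _) hmN
      have hm1 : 2 * K ≤ m := by
        have : (⌈2 * K⌉₊ : ℝ) ≤ m := by
          exact_mod_cast (Nat.le_succ _).trans ((le_max_right _ _).trans hmN)
        exact (Nat.le_ceil _).trans this
      have hb := h m hm0
      have hmpos : (0 : ℝ) < m := by exact_mod_cast hm
      rw [abs_of_nonneg (mul_nonneg hmpos.le (hn m))] at hb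
      have s1 : ∑ j ∈ Finset.range m, n j * n (m - j) ≤ m * (a * a * R ^ m) := by
        have : ∀ j ∈ Finset.range m, n j * n (m - j) ≤ a * a * R ^ m := by
          intro j hj
          rw [Finset.mem_range] at hj
          rcases Nat.eq_zero_or_pos j with rfl | hj0
          -- The term `j = 0` contains `n m`, which the induction does not yet control; it drops out
          -- because `n 0 = 0`.
          · rw [h0, zero_mul]; positivity
          calc n j * n (m - j) ≤ (a * R ^ j) * (a * R ^ (m - j)) :=
                mul_le_mul (ih j hj) (ih _ (by omega)) (hn _) (by positivity)
            _ = a * a * (R ^ j * R ^ (m - j)) := by ring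
            _ = a * a * R ^ m := by rw [← pow_add, Nat.add_sub_cancel' hj.le]
        simpa using Finset.sum_le_sum this
      have s2 : ∑ j ∈ Finset.range m, n j ≤ m * (a * R ^ (m - 1)) := by
        have : ∀ j ∈ Finset.range m, n j ≤ a * R ^ (m - 1) := by
          intro j hj
          rw [Finset.mem_range] at hj
          refine (ih j hj).trans ?_
          gcongr
          omega
        simpa using Finset.sum_le_sum this
      have hRm : R ^ m = R * R ^ (m - 1) := by
        rw [← pow_succ', Nat.sub_add_cancel hm]
      have hP : 0 < R ^ (m - 1) := by positivity
      have hKa : K * a = 1 / 4 := by rw [ha]; field_simp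
      have b1 : (m : ℝ) * n m ≤ K * (n m + m * (a * a * R ^ m) + m * (a * R ^ (m - 1))) := by
        refine hb.trans (mul_le_mul hKK (by linarith) ?_ hK.le)
        have := Finset.sum_nonneg (s := Finset.range m) fun j _ => hn j
        have := Finset.sum_nonneg (s := Finset.range m) fun j _ => mul_nonneg (hn j) (hn (m - j))
        linarith [hn m]
      have b2 : K * (m * (a * a * R ^ m)) = m * (a * R ^ m) / 4 := by
        calc K * (m * (a * a * R ^ m)) = (K * a) * (m * (a * R ^ m)) := by ring
          _ = _ := by rw [hKa]; ring
      have b3 : K * (m * (a * R ^ (m - 1))) ≤ m * (a * R ^ m) / 4 := by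
        have : (4 * K) * (m * (a * R ^ (m - 1))) ≤ R * (m * (a * R ^ (m - 1))) := by gcongr
        rw [hRm]
        linarith
      have b4 : K * n m ≤ m * n m / 2 := by
        have := mul_le_mul_of_nonneg_right hm1 (hn m)
        linarith
      have b5 : (m : ℝ) * n m ≤ m * (a * R ^ m) := by linarith
      exact le_of_mul_le_mul_left b5 hmpos

/-! ### Coefficient recursion of a quadratic singular system -/

/-- A sequence can be prescribed recursively if each condition `P m` depends only on the terms up
to `m` and can be satisfied by the choice of the term `m`. -/
lemma exists_seq_of_forall_extend {E : Type*} (P : ℕ → (ℕ → E) → Prop) (N : ℕ)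
    (hP : ∀ m u u', (∀ j ≤ m, u j = u' j) → P m u → P m u')
    (u₀ : ℕ → E) (h₀ : ∀ m < N, P m u₀)
    (step : ∀ m ≥ N, ∀ u, (∀ j < N, u j = u₀ j) → ∃ x, P m (Function.update u m x)) :
    ∃ u, (∀ j < N, u j = u₀ j) ∧ ∀ m, P m u := by
  have step' : ∀ m, ∀ u : {u : ℕ → E // ∀ j < N, u j = u₀ j}, ∃ u' : {u : ℕ → E // ∀ j < N, u j = u₀ j},
      P (N + m) u'.1 ∧ ∀ j < N + m, u'.1 j = u.1 j := by
    intro m u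
    obtain ⟨x, hx⟩ := step (N + m) (Nat.le_add_right _ _) u.1 u.2
    refine ⟨⟨Function.update u.1 (N + m) x, fun j hj => ?_⟩, hx, fun j hj => ?_⟩
    · rw [Function.update_of_ne (by omega), u.2 j hj]
    · exact Function.update_of_ne (by omega) _ _
  choose F hF1 hF2 using step'
  let w : ℕ → {u : ℕ → E // ∀ j < N, u j = u₀ j} := fun n => Nat.rec ⟨u₀, fun _ _ => rfl⟩ F n
  have hw : ∀ n, w (n + 1) = F n (w n) := fun n => rfl
  have hagree : ∀ k n j, j < N + n → (w (n + k)).1 j = (w n).1 j := by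
    intro k
    induction k with
    | zero => intros; rfl
    | succ k ih =>
      intro n j hj
      rw [← add_assoc, hw, hF2 _ _ j (by omega), ih n j hj]
  -- Stage `n` has fixed all terms of index below `N + n`, so the term `j` can be read off at stage
  -- `j + 1`.
  refine ⟨fun j => (w (j + 1)).1 j, fun j hj => (w (j + 1)).2 j hj, fun m => ?_⟩
  rcases lt_or_ge m N with hm | hm
  · exact hP m u₀ _ (fun j hj => ((w (j + 1)).2 j (by omega)).symm) (h₀ m hm)
  · obtain ⟨n, rfl⟩ := Nat.exists_eq_add_of_le hm
    refine hP (N + n) (w (n + 1)).1 _ (fun j hj => ?_) (by rw [hw]; exact hF1 _ _)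
    rcases le_total (j + 1) (n + 1) with h | h
    · obtain ⟨k, hk⟩ := Nat.exists_eq_add_of_le h
      rw [hk]
      exact hagree k (j + 1) j (by omega)
    · obtain ⟨k, hk⟩ := Nat.exists_eq_add_of_le h
      rw [hk]
      exact (hagree k (n + 1) j (by omega)).symm

/-- The data of the singular system `t V_i' + (V_i + ε_i) (∑ d_j V_j + ∑ d_j ε_j - 1) =
∑ₐ C_{ia} t ^ κ_a Mₐ - λ t ^ 2`, `t Mₐ' = (∑ γ_{aj} V_j) Mₐ`, `V(0) = 0`, `M(0) = w`. -/
structure SingularSystem (ι α : Type*) where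
  eps : ι → ℝ
  mult : ι → ℝ
  coef : ι → α → ℝ
  expo : α → ι → ℝ
  shift : α → ℕ
  init : α → ℝ
  lam : ℝ

namespace SingularSystem

variable {ι α : Type*} [Fintype ι] (S : SingularSystem ι α)

/-- The part of the coefficient of order `m` of `(∑ γ_{aj} V_j) Mₐ` that involves lower orders. -/
def lowerMonomial (m : ℕ) (u : ℕ → (ι → ℝ) × (α → ℝ)) (a : α) : ℝ :=
  ∑ k ∈ Finset.Ico 1 m, (∑ j, S.expo a j * (u k).1 j) * (u (m - k)).2 a

/-- The part of the coefficient of order `m` of `V_i ∑ d_j V_j` that involves lower orders. -/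
def lowerQuadratic (m : ℕ) (u : ℕ → (ι → ℝ) × (α → ℝ)) (i : ι) : ℝ :=
  ∑ k ∈ Finset.Ico 1 m, (u k).1 i * ∑ j, S.mult j * (u (m - k)).1 j

lemma lowerMonomial_congr {m : ℕ} {u u' : ℕ → (ι → ℝ) × (α → ℝ)} (h : ∀ j < m, u j = u' j) :
    S.lowerMonomial m u = S.lowerMonomial m u' := by
  funext a
  refine Finset.sum_congr rfl fun k hk => ?_
  have := Finset.mem_Ico.1 hk
  rw [h k (by omega), h (m - k) (by omega)]

lemma lowerQuadratic_congr {m : ℕ} {u u' : ℕ → (ι → ℝ) × (α → ℝ)} (h : ∀ j < m, u j = u' j) :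
    S.lowerQuadratic m u = S.lowerQuadratic m u' := by
  funext i
  refine Finset.sum_congr rfl fun k hk => ?_
  have := Finset.mem_Ico.1 hk
  rw [h k (by omega), h (m - k) (by omega)]

variable [Fintype α]

/-- The number `∑ d_j ε_j - 1`. -/
def weight : ℝ := ∑ j, S.mult j * S.eps j - 1

/-- The linear operator governing the coefficient of order `m`. -/
def indicial (m : ℕ) : (ι → ℝ) →ₗ[ℝ] (ι → ℝ) where
  -- The quotient by `m` comes from eliminating the order-`m` coefficient of `Mₐ` through its own
  -- equation. Only monomials of shift zero bring that coefficient into order `m`.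
  toFun v i := (m + S.weight) * v i + S.eps i * ∑ j, S.mult j * v j -
    ∑ a, S.coef i a * if S.shift a = 0 then (∑ j, S.expo a j * v j) * S.init a / m else 0
  map_add' v w := by
    funext i
    simp only [Pi.add_apply, mul_add, Finset.sum_add_distrib, add_mul, add_div, ite_add_zero]
    ring
  map_smul' c v := by
    funext i
    have h1 : ∀ f : ι → ℝ, ∑ j, f j * (c * v j) = c * ∑ j, f j * v j := fun f => by
      rw [Finset.mul_sum]
      exact Finset.sum_congr rfl fun j _ => by ring
    have h3 : ∀ f : α → ℝ, ∑ a, S.coef i a * (c * f a) = c * ∑ a, S.coef i a * f a := fun f => by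
      rw [Finset.mul_sum]
      exact Finset.sum_congr rfl fun j _ => by ring
    have h2 : ∀ a, (if S.shift a = 0 then (c * ∑ j, S.expo a j * v j) * S.init a / m else 0) =
        c * if S.shift a = 0 then (∑ j, S.expo a j * v j) * S.init a / m else 0 := fun a => by
      split_ifs
      · ring
      · simp
    simp only [Pi.smul_apply, smul_eq_mul, h1, h2, RingHom.id_apply]
    rw [h3]
    ring

/-- The right-hand side in order two. -/
def source (i : ι) : ℝ := (∑ a, S.coef i a * if S.shift a = 2 then S.init a else 0) - S.lam

/-- The equations of order zero. -/
def Balanced : Prop :=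
  ∀ i, S.eps i * S.weight = ∑ a, S.coef i a * if S.shift a = 0 then S.init a else 0

/-- The equation for the coefficients of order `m ≥ 1`. -/
def CoeffEq (m : ℕ) (u : ℕ → (ι → ℝ) × (α → ℝ)) : Prop :=
  (∀ a, m * (u m).2 a = (∑ j, S.expo a j * (u m).1 j) * S.init a +
    S.lowerMonomial m u a) ∧
  ∀ i, (m + S.weight) * (u m).1 i + S.eps i * ∑ j, S.mult j * (u m).1 j + S.lowerQuadratic m u i =
    (∑ a, S.coef i a * if S.shift a ≤ m then (u (m - S.shift a)).2 a else 0) -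
      if m = 2 then S.lam else 0

lemma coeffEq_congr {m : ℕ} {u u' : ℕ → (ι → ℝ) × (α → ℝ)} (h : ∀ j ≤ m, u j = u' j)
    (hu : S.CoeffEq m u) : S.CoeffEq m u' := by
  have h' : ∀ j < m, u j = u' j := fun j hj => h j hj.le
  refine ⟨fun a => ?_, fun i => ?_⟩
  · rw [← h m le_rfl, hu.1 a, S.lowerMonomial_congr h']
  · have := hu.2 i
    simpa only [h m le_rfl, fun k => h (m - k) (Nat.sub_le _ _), S.lowerQuadratic_congr h'] using
      this

/-- Beyond order two the `lam` term is absent. Surjectivity of the indicial operator yields the `V`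
part, and the `M` part is then obtained on dividing by `m`. -/
lemma exists_coeff_step {m : ℕ} (hm : 3 ≤ m) (hT : Function.Surjective (S.indicial m))
    (u : ℕ → (ι → ℝ) × (α → ℝ)) : ∃ x, S.CoeffEq m (Function.update u m x) := by
  have hm0 : (m : ℝ) ≠ 0 := by positivity
  obtain ⟨v, hv⟩ := hT fun i =>
    (∑ a, S.coef i a * if S.shift a = 0 then S.lowerMonomial m u a / m
      else if S.shift a ≤ m then (u (m - S.shift a)).2 a else 0) - S.lowerQuadratic m u i
  refine ⟨(v, fun a => ((∑ j, S.expo a j * v j) * S.init a + S.lowerMonomial m u a) / m), ?_⟩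
  have e : ∀ x, ∀ j < m, Function.update u m x j = u j := fun x j hj =>
    Function.update_of_ne hj.ne _ _
  refine ⟨fun a => ?_, fun i => ?_⟩
  · rw [S.lowerMonomial_congr (e _)]
    simp only [Function.update_self]
    field_simp
  · rw [S.lowerQuadratic_congr (e _)]
    simp only [Function.update_self]
    have h := congrFun hv i
    simp only [indicial, LinearMap.coe_mk, AddHom.coe_mk] at h
    rw [if_neg (by omega), sub_zero]
    rw [sub_eq_iff_eq_add] at h
    rw [h, sub_add_eq_add_sub, sub_add_cancel, ← Finset.sum_add_distrib]
    refine Finset.sum_congr rfl fun a _ => ?_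
    rw [← mul_add]
    congr 1
    by_cases h0 : S.shift a = 0
    · simp only [h0, if_true, zero_le, Nat.sub_zero, Function.update_self]
      ring
    · simp only [h0, if_false, add_zero]
      split_ifs with h1
      · rw [Function.update_of_ne (by omega)]
      · rfl

/-- The free datum is `q`, in order two. Order one vanishes consistently because no monomial has
shift one, which would feed its initial value into that order. -/
lemma exists_coeff_seq (hT : ∀ m ≥ 3, Function.Surjective (S.indicial m))
    (hshift : ∀ a, S.shift a ≠ 1) {q : ι → ℝ} (hq : S.indicial 2 q = S.source) :
    ∃ u : ℕ → (ι → ℝ) × (α → ℝ), u 0 = (0, S.init) ∧ (u 1).1 = 0 ∧ (u 2).1 = q ∧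
      ∀ m ≥ 1, S.CoeffEq m u := by
  -- Only the orders 0, 1, 2 of this seed are used; its values from order three on are placeholders.
  let u₀ : ℕ → (ι → ℝ) × (α → ℝ) := fun m => if m = 0 then (0, S.init) else if m = 1 then (0, 0)
    else (q, fun a => (∑ j, S.expo a j * q j) * S.init a / 2)
  have h₁ : S.CoeffEq 1 u₀ := by
    refine ⟨fun a => by simp [u₀, lowerMonomial], fun i => ?_⟩
    have : ∀ a, (if S.shift a ≤ 1 then (u₀ (1 - S.shift a)).2 a else 0) = 0 := fun a => by
      have := hshift a
      split_ifs with h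
      · have h0 : S.shift a = 0 := by omega
        simp [h0, u₀]
      · rfl
    simp only [this]
    simp [u₀, lowerQuadratic]
  have h₂ : S.CoeffEq 2 u₀ := by
    refine ⟨fun a => ?_, fun i => ?_⟩
    · have : Finset.Ico 1 2 = {1} := rfl
      simp [lowerMonomial, this, u₀]
      ring
    · have : Finset.Ico 1 2 = {1} := rfl
      have h := congrFun hq i
      simp only [indicial, LinearMap.coe_mk, AddHom.coe_mk, source] at h
      simp only [lowerQuadratic, this, Finset.sum_singleton, if_true]
      rw [sub_eq_iff_eq_add] at h
      have hl : (u₀ 2).1 = q := rfl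
      have hl1 : (u₀ 1).1 = 0 := rfl
      rw [hl, hl1, h, Pi.zero_apply, zero_mul, add_zero, sub_add_eq_add_sub,
        ← Finset.sum_add_distrib]
      congr 1
      refine Finset.sum_congr rfl fun a _ => ?_
      rw [← mul_add]
      congr 1
      have := hshift a
      rcases Nat.lt_or_ge 2 (S.shift a) with hs | hs
      · rw [if_neg (by omega), if_neg (by omega), if_neg (by omega), add_zero]
      · have : S.shift a = 0 ∨ S.shift a = 2 := by omega
        rcases this with h | h <;> simp [h, u₀]
  obtain ⟨u, hu, hP⟩ := exists_seq_of_forall_extend (fun m u => 1 ≤ m → S.CoeffEq m u) 3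
    (fun m u u' h hu hm => S.coeffEq_congr h (hu hm)) u₀
    (fun m hm hm' => by
      interval_cases m
      exacts [h₁, h₂])
    (fun m hm u _ => (S.exists_coeff_step hm (hT m hm) u).imp fun _ h _ => h)
  refine ⟨u, ?_, ?_, ?_, hP⟩
  · simp [hu 0 (by norm_num), u₀]
  · simp [hu 1 (by norm_num), u₀]
  · simp [hu 2 (by norm_num), u₀]

/-- Once the lower orders agree, the difference of the `V` parts in order `m` lies in the kernel of
`indicial m`. Orders one and two are assumed to agree, since there the kernel may be nonzero. -/
lemma coeff_seq_unique (hT : ∀ m ≥ 3, Function.Injective (S.indicial m))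
    {u u' : ℕ → (ι → ℝ) × (α → ℝ)} (h0 : u 0 = u' 0) (h1 : (u 1).1 = (u' 1).1)
    (h2 : (u 2).1 = (u' 2).1) (hu : ∀ m ≥ 1, S.CoeffEq m u) (hu' : ∀ m ≥ 1, S.CoeffEq m u') :
    u = u' := by
  funext m
  induction m using Nat.strong_induction_on with
  | _ m ih =>
    rcases Nat.eq_zero_or_pos m with rfl | hm
    · exact h0
    have hm0 : (m : ℝ) ≠ 0 := by positivity
    have k1 : ∀ a, (u m).2 a - (u' m).2 a =
        (∑ j, S.expo a j * ((u m).1 j - (u' m).1 j)) * S.init a / m := by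
      intro a
      have a1 := (hu m hm).1 a
      rw [S.lowerMonomial_congr ih] at a1
      rw [eq_div_iff hm0]
      simp only [mul_sub, Finset.sum_sub_distrib]
      linear_combination a1 - (hu' m hm).1 a
    have k2 : (u m).1 = (u' m).1 := by
      rcases (by omega : m = 1 ∨ m = 2 ∨ 3 ≤ m) with rfl | rfl | hm3
      · exact h1
      · exact h2
      rw [← sub_eq_zero]
      refine (map_eq_zero_iff _ (hT m hm3)).1 (funext fun i => ?_)
      have a1 := (hu m hm).2 i
      rw [S.lowerQuadratic_congr ih] at a1
      have a2 := (hu' m hm).2 i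
      simp only [indicial, LinearMap.coe_mk, AddHom.coe_mk, Pi.sub_apply, Pi.zero_apply, ← k1]
      have k3 : ∑ a, S.coef i a * (if S.shift a ≤ m then (u (m - S.shift a)).2 a else 0) -
          ∑ a, S.coef i a * (if S.shift a ≤ m then (u' (m - S.shift a)).2 a else 0) =
          ∑ a, S.coef i a * if S.shift a = 0 then (u m).2 a - (u' m).2 a else 0 := by
        rw [← Finset.sum_sub_distrib]
        refine Finset.sum_congr rfl fun a _ => ?_
        rw [← mul_sub]
        congr 1
        by_cases h : S.shift a = 0
        · simp [h]
        · rw [if_neg h]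
          split_ifs with h'
          · rw [ih _ (by omega), sub_self]
          · simp
      rw [← k3]
      simp only [mul_sub, Finset.sum_sub_distrib]
      linear_combination a1 - a2
    refine Prod.ext k2 (funext fun a => ?_)
    have := k1 a
    simp only [k2, sub_self, mul_zero, Finset.sum_const_zero, zero_mul, zero_div] at this
    exact sub_eq_zero.1 this

lemma indicial_two_eq_source (hshift : ∀ a, S.shift a ≠ 1) {u : ℕ → (ι → ℝ) × (α → ℝ)}
    (h0 : u 0 = (0, S.init)) (h1 : (u 1).1 = 0) (hu : ∀ m ≥ 1, S.CoeffEq m u) :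
    S.indicial 2 (u 2).1 = S.source := by
  funext i
  have h : Finset.Ico 1 2 = {1} := rfl
  have hM : ∀ a, (u 2).2 a = (∑ j, S.expo a j * (u 2).1 j) * S.init a / 2 := by
    intro a
    have := (hu 2 (by norm_num)).1 a
    rw [lowerMonomial, h, Finset.sum_singleton, h1] at this
    simp at this
    linarith
  have hV := (hu 2 (by norm_num)).2 i
  rw [lowerQuadratic, h, Finset.sum_singleton, h1, if_pos rfl] at hV
  simp only [indicial, LinearMap.coe_mk, AddHom.coe_mk, source]
  rw [sub_eq_iff_eq_add]
  simp only [Pi.zero_apply, zero_mul, add_zero] at hV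
  rw [hV, sub_add_eq_add_sub, ← Finset.sum_add_distrib]
  congr 1
  refine Finset.sum_congr rfl fun a _ => ?_
  rw [← mul_add]
  congr 1
  have := hshift a
  rcases Nat.lt_or_ge 2 (S.shift a) with hs | hs
  · rw [if_neg (by omega), if_neg (by omega), if_neg (by omega), add_zero]
  · have : S.shift a = 0 ∨ S.shift a = 2 := by omega
    rcases this with h | h <;> simp [h, hM, h0]

end SingularSystem

/-! ### Singular systems for formal power series -/

namespace PowerSeries

lemma coeff_X_mul_derivative (p : PowerSeries ℝ) (m : ℕ) :
    coeff m (X * d⁄dX ℝ p) = m * coeff m p := by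
  cases m with
  | zero => simp
  | succ m => rw [coeff_succ_X_mul, coeff_derivative]; push_cast; ring

lemma coeff_mul_of_constantCoeff_eq_zero {p : PowerSeries ℝ} (hp : constantCoeff p = 0)
    (q : PowerSeries ℝ) {m : ℕ} (hm : 1 ≤ m) :
    coeff m (p * q) = coeff m p * constantCoeff q +
      ∑ k ∈ Finset.Ico 1 m, coeff k p * coeff (m - k) q := by
  rw [coeff_mul, Finset.Nat.sum_antidiagonal_eq_sum_range_succ fun i j => coeff i p * coeff j q,
    Finset.sum_range_succ, Finset.range_eq_Ico, Finset.sum_eq_sum_Ico_succ_bot (by omega)]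
  simp [hp, add_comm]

end PowerSeries

namespace SingularSystem

open PowerSeries

variable {ι α : Type*} (S : SingularSystem ι α)

/-- The sequence of coefficients. -/
def coeffSeq (V : ι → PowerSeries ℝ) (M : α → PowerSeries ℝ) (m : ℕ) : (ι → ℝ) × (α → ℝ) :=
  (fun i => coeff m (V i), fun a => coeff m (M a))

variable {S} {V : ι → PowerSeries ℝ} {M : α → PowerSeries ℝ}

lemma coeff_source [Fintype α] {m : ℕ} (i : ι) :
    coeff m (∑ a, C (S.coef i a) * (X ^ S.shift a * M a) - C S.lam * X ^ 2) =
      (∑ a, S.coef i a * if S.shift a ≤ m then (coeffSeq V M (m - S.shift a)).2 a else 0) -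
        if m = 2 then S.lam else 0 := by
  simp [coeff_X_pow_mul', coeffSeq, coeff_X_pow]

variable [Fintype ι]

lemma coeff_monomial (hV : ∀ i, constantCoeff (V i) = 0)
    (hM : ∀ a, constantCoeff (M a) = S.init a) {m : ℕ} (hm : 1 ≤ m) (a : α) :
    coeff m ((∑ j, C (S.expo a j) * V j) * M a) =
      (∑ j, S.expo a j * coeff m (V j)) * S.init a + S.lowerMonomial m (coeffSeq V M) a := by
  rw [coeff_mul_of_constantCoeff_eq_zero (by simp [hV]) _ hm, hM]
  simp [lowerMonomial, coeffSeq]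

lemma coeff_equation (hV : ∀ i, constantCoeff (V i) = 0) {m : ℕ} (hm : 1 ≤ m) (i : ι) :
    coeff m ((V i + C (S.eps i)) * (∑ j, C (S.mult j) * V j + C S.weight)) =
      S.weight * coeff m (V i) + S.eps i * ∑ j, S.mult j * coeff m (V j) +
        S.lowerQuadratic m (coeffSeq V M) i := by
  have hm0 : m ≠ 0 := by omega
  have : (V i + C (S.eps i)) * (∑ j, C (S.mult j) * V j + C S.weight) =
      V i * (∑ j, C (S.mult j) * V j) + C S.weight * V i + C (S.eps i) * (∑ j, C (S.mult j) * V j)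
        + C (S.eps i * S.weight) := by
    rw [map_mul]
    ring
  rw [this]
  simp only [map_add, coeff_C_mul, map_sum, coeff_C, if_neg hm0,
    coeff_mul_of_constantCoeff_eq_zero (hV i) _ hm]
  simp [hV, lowerQuadratic, coeffSeq]
  ring

variable [Fintype α]

variable (S V M) in
/-- Formal power series solutions of a singular system. -/
structure IsSeriesSolution : Prop where
  constantCoeff_left : ∀ i, constantCoeff (V i) = 0
  constantCoeff_right : ∀ a, constantCoeff (M a) = S.init a
  monomial : ∀ a, X * d⁄dX ℝ (M a) = (∑ j, C (S.expo a j) * V j) * M a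
  equation : ∀ i, X * d⁄dX ℝ (V i) + (V i + C (S.eps i)) * (∑ j, C (S.mult j) * V j + C S.weight) =
    ∑ a, C (S.coef i a) * (X ^ S.shift a * M a) - C S.lam * X ^ 2

/-- Comparison of coefficients: order zero of the second equation is `Balanced`, and order `m ≥ 1`
is `CoeffEq m`. -/
lemma isSeriesSolution_iff (hS : S.Balanced) (hV : ∀ i, constantCoeff (V i) = 0)
    (hM : ∀ a, constantCoeff (M a) = S.init a) :
    S.IsSeriesSolution V M ↔ ∀ m ≥ 1, S.CoeffEq m (coeffSeq V M) := by
  constructor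
  · intro h m hm
    refine ⟨fun a => ?_, fun i => ?_⟩
    · have := congrArg (coeff m) (h.monomial a)
      rwa [coeff_X_mul_derivative, coeff_monomial hV hM hm] at this
    · have := congrArg (coeff m) (h.equation i)
      rw [map_add, coeff_X_mul_derivative, coeff_equation (M := M) hV hm,
        coeff_source (V := V)] at this
      rw [← this]
      simp only [coeffSeq]
      ring
  · intro h
    refine ⟨hV, hM, fun a => PowerSeries.ext fun m => ?_, fun i => PowerSeries.ext fun m => ?_⟩
    · rcases Nat.eq_zero_or_pos m with rfl | hm
      · simp [hV]
      · rw [coeff_X_mul_derivative, coeff_monomial hV hM hm]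
        exact (h m hm).1 a
    · rcases Nat.eq_zero_or_pos m with rfl | hm
      · rw [coeff_source (V := V)]
        have : ∀ a, (if S.shift a ≤ 0 then (coeffSeq V M (0 - S.shift a)).2 a else 0) =
            if S.shift a = 0 then S.init a else 0 := fun a => by
          simp only [Nat.le_zero, coeffSeq]
          split_ifs with h
          · simp [hM]
          · rfl
        simp only [this]
        rw [← hS i]
        simp [hV]
      · rw [map_add, coeff_X_mul_derivative, coeff_equation (M := M) hV hm,
          coeff_source (V := V), ← (h m hm).2 i]
        simp only [coeffSeq]
        ring

/-! ### Convergence of the formal solutions -/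

lemma quadraticallyDominated_conv {n x y : ℕ → ℝ} {K : ℝ} (hn : ∀ m, 0 ≤ n m) (hK : 0 ≤ K)
    (hx : ∀ m ≥ 1, |x m| ≤ K * n m) (hy : ∀ m ≥ 1, |y m| ≤ n m) :
    QuadraticallyDominated n fun m => ∑ k ∈ Finset.Ico 1 m, x k * y (m - k) := by
  refine ⟨K, hK, 0, fun m _ => ?_⟩
  have h1 : ∑ k ∈ Finset.Ico 1 m, |x k * y (m - k)| ≤
      K * ∑ k ∈ Finset.range m, n k * n (m - k) := by
    rw [Finset.mul_sum]
    calc ∑ k ∈ Finset.Ico 1 m, |x k * y (m - k)|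
        ≤ ∑ k ∈ Finset.Ico 1 m, K * (n k * n (m - k)) := by
          refine Finset.sum_le_sum fun k hk => ?_
          have := Finset.mem_Ico.1 hk
          rw [abs_mul, ← mul_assoc]
          exact mul_le_mul (hx k this.1) (hy _ (by omega)) (abs_nonneg _)
            (mul_nonneg hK (hn _))
      _ ≤ _ := Finset.sum_le_sum_of_subset_of_nonneg
          (fun k hk => Finset.mem_range.2 (Finset.mem_Ico.1 hk).2)
          fun k _ _ => mul_nonneg hK (mul_nonneg (hn _) (hn _))
  have h2 := mul_nonneg hK (hn m)
  have h3 := mul_nonneg hK (Finset.sum_nonneg (s := Finset.range m) fun j _ => hn j)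
  rw [mul_add, mul_add]
  linarith [Finset.abs_sum_le_sum_abs (fun k => x k * y (m - k)) (Finset.Ico 1 m)]

/-- A positive shift is absorbed by the partial sum, and the zero shift by the term `n m`. The
threshold `k + 1` keeps `m - k ≥ 1`, where the bound on `x` holds. -/
lemma quadraticallyDominated_shift {n x : ℕ → ℝ} (hn : ∀ m, 0 ≤ n m)
    (hx : ∀ m ≥ 1, |x m| ≤ n m) (k : ℕ) :
    QuadraticallyDominated n fun m => if k ≤ m then x (m - k) else 0 := by
  refine ⟨1, zero_le_one, k + 1, fun m hm => ?_⟩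
  have s1 := Finset.sum_nonneg (s := Finset.range m) fun j _ => hn j
  have s2 := Finset.sum_nonneg (s := Finset.range m) fun j _ => mul_nonneg (hn j) (hn (m - j))
  simp only [if_pos (by omega : k ≤ m), one_mul]
  have := hx (m - k) (by omega)
  rcases Nat.eq_zero_or_pos k with rfl | hk
  · simp only [Nat.sub_zero] at this ⊢
    linarith
  · have h1 := Finset.single_le_sum (f := n) (fun j _ => hn j)
      (Finset.mem_range.2 (by omega : m - k < m))
    linarith [hn m]

lemma quadraticallyDominated_abs {n x : ℕ → ℝ} (hx : QuadraticallyDominated n x) :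
    QuadraticallyDominated n fun m => |x m| := by
  simpa [QuadraticallyDominated] using hx

lemma quadraticallyDominated_congr {n x y : ℕ → ℝ} (m₀ : ℕ) (h : ∀ m ≥ m₀, x m = y m)
    (hx : QuadraticallyDominated n x) : QuadraticallyDominated n y := by
  obtain ⟨K, hK, m₁, hx⟩ := hx
  refine ⟨K, hK, max m₀ m₁, fun m hm => ?_⟩
  rw [← h m ((le_max_left _ _).trans hm)]
  exact hx m ((le_max_right _ _).trans hm)

/-- The solutions of the recursion have geometric growth. -/
theorem exists_coeff_bound {u : ℕ → (ι → ℝ) × (α → ℝ)} (hu : ∀ m ≥ 1, S.CoeffEq m u) :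
    ∃ a R : ℝ, ∀ m ≥ 1, (∀ i, |(u m).1 i| ≤ a * R ^ m) ∧ ∀ b, |(u m).2 b| ≤ a * R ^ m := by
  -- Order zero is replaced by 0 because the initial values of the monomials do not vanish; their
  -- products with the top order are accounted for as linear terms.
  set n : ℕ → ℝ := fun m => if m = 0 then 0 else ∑ i, |(u m).1 i| + ∑ b, |(u m).2 b| with hn
  have hn0 : ∀ m, 0 ≤ n m := fun m => by
    simp only [hn]
    split_ifs <;> positivity
  have hnm : ∀ m ≥ 1, n m = ∑ i, |(u m).1 i| + ∑ b, |(u m).2 b| := fun m hm => by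
    simp only [hn]
    rw [if_neg (by omega)]
  have hx : ∀ i, ∀ m ≥ 1, |(u m).1 i| ≤ n m := fun i m hm => by
    rw [hnm m hm]
    have := Finset.single_le_sum (f := fun i => |(u m).1 i|) (fun _ _ => abs_nonneg _)
      (Finset.mem_univ i)
    have : 0 ≤ ∑ b, |(u m).2 b| := by positivity
    linarith
  have hy : ∀ b, ∀ m ≥ 1, |(u m).2 b| ≤ n m := fun b m hm => by
    rw [hnm m hm]
    have := Finset.single_le_sum (f := fun b => |(u m).2 b|) (fun _ _ => abs_nonneg _)
      (Finset.mem_univ b)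
    have : 0 ≤ ∑ i, |(u m).1 i| := by positivity
    linarith
  have hlin : ∀ c : ι → ℝ, ∀ m ≥ 1, |∑ j, c j * (u m).1 j| ≤ (∑ j, |c j|) * n m := by
    intro c m hm
    rw [Finset.sum_mul]
    refine (Finset.abs_sum_le_sum_abs _ _).trans (Finset.sum_le_sum fun j _ => ?_)
    rw [abs_mul]
    exact mul_le_mul_of_nonneg_left (hx j m hm) (abs_nonneg _)
  have hlin' : ∀ c : ι → ℝ, QuadraticallyDominated n fun m => ∑ j, c j * (u m).1 j := by
    intro c
    have := QuadraticallyDominated.sum Finset.univ (b := fun j => c j • fun m => (u m).1 j)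
      fun j _ => by
        simpa using (quadraticallyDominated_shift hn0 (hx j) 0).smul (c j)
    refine quadraticallyDominated_congr 0 (fun m _ => ?_) this
    simp
  have hM : ∀ b, QuadraticallyDominated n fun m => m * |(u m).2 b| := by
    intro b
    have h1 : QuadraticallyDominated n fun m => S.lowerMonomial m u b :=
      quadraticallyDominated_conv (x := fun k => ∑ j, S.expo b j * (u k).1 j)
        (y := fun k => (u k).2 b) (K := ∑ j, |S.expo b j|) hn0 (by positivity)
        (fun m hm => hlin _ m hm) (hy b)
    have h2 := (((hlin' (S.expo b)).smul (S.init b)).add h1)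
    refine quadraticallyDominated_congr 1 (fun m hm => ?_) (quadraticallyDominated_abs h2)
    have := (hu m hm).1 b
    rw [← Nat.abs_cast m, ← abs_mul, this]
    simp only [Pi.add_apply, Pi.smul_apply, smul_eq_mul]
    ring_nf
  have hV : ∀ i, QuadraticallyDominated n fun m => m * |(u m).1 i| := by
    intro i
    -- The factors are exchanged so that the linear form `∑ d_j V_j` takes the slot that admits a
    -- constant; `h1'` reverses the order of summation.
    have h1 : QuadraticallyDominated n fun m =>
        ∑ k ∈ Finset.Ico 1 m, (∑ j, S.mult j * (u k).1 j) * (u (m - k)).1 i :=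
      quadraticallyDominated_conv (x := fun k => ∑ j, S.mult j * (u k).1 j)
        (y := fun k => (u k).1 i) (K := ∑ j, |S.mult j|) hn0 (by positivity)
        (fun m hm => hlin _ m hm) (hx i)
    have h1' : ∀ m, ∑ k ∈ Finset.Ico 1 m, (∑ j, S.mult j * (u k).1 j) * (u (m - k)).1 i =
        S.lowerQuadratic m u i := by
      intro m
      have := Finset.sum_Ico_reflect (fun k => (∑ j, S.mult j * (u k).1 j) * (u (m - k)).1 i) 1
        (Nat.le_succ m)
      have e1 : m + 1 - m = 1 := by omega
      have e2 : m + 1 - 1 = m := by omega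
      rw [e1, e2] at this
      rw [← this, lowerQuadratic]
      refine Finset.sum_congr rfl fun k hk => ?_
      have := Finset.mem_Ico.1 hk
      have e3 : m - (m - k) = k := by omega
      rw [e3, mul_comm]
    simp only [h1'] at h1
    have h2 := QuadraticallyDominated.sum Finset.univ
      (b := fun a => S.coef i a • fun m =>
        if S.shift a ≤ m then (u (m - S.shift a)).2 a else 0)
      fun a _ => (quadraticallyDominated_shift hn0 (hy a) _).smul (S.coef i a)
    have h3 := (quadraticallyDominated_shift hn0 (hx i) 0).smul (-S.weight)
    have h4 := (((hlin' S.mult).smul (-S.eps i)).add (h1.smul (-1))).add (h2.add h3)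
    -- Starting at order three removes the `lam` term.
    refine quadraticallyDominated_congr 3 (fun m hm => ?_) (quadraticallyDominated_abs h4)
    have := (hu m (by omega)).2 i
    rw [if_neg (by omega)] at this
    rw [← Nat.abs_cast m, ← abs_mul]
    congr 1
    simp only [Pi.add_apply, Pi.smul_apply, smul_eq_mul, Finset.sum_apply, zero_le, if_true,
      Nat.sub_zero]
    linarith
  obtain ⟨a, R, h⟩ := exists_geometric_bound hn0 (by simp [hn]) (by
    have h1 := QuadraticallyDominated.sum Finset.univ fun i _ => hV i
    have h2 := QuadraticallyDominated.sum Finset.univ fun b _ => hM b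
    refine quadraticallyDominated_congr 1 (fun m hm => ?_) (h1.add h2)
    rw [hnm m hm]
    simp [mul_add, Finset.mul_sum])
  exact ⟨a, R, fun m hm => ⟨fun i => (hx i m hm).trans (h m), fun b => (hy b m hm).trans (h m)⟩⟩

end SingularSystem

/-! ### Analytic solutions in logarithmic variables -/

namespace HasExpansion

open PowerSeries

lemma exists_of_coeff_bound {p : PowerSeries ℝ} {a R : ℝ}
    (hp : ∀ n ≥ 1, |coeff n p| ≤ a * R ^ n) : ∃ g, HasExpansion g p := by
  refine ⟨_, of_coeff_bound (a := |a| + |coeff 0 p|) (R := |R| + 1) fun n => ?_⟩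
  rcases Nat.eq_zero_or_pos n with rfl | hn
  · simp
  · calc |coeff n p| ≤ |a * R ^ n| := (hp n hn).trans (le_abs_self _)
      _ = |a| * |R| ^ n := by rw [abs_mul, abs_pow]
      _ ≤ (|a| + |coeff 0 p|) * (|R| + 1) ^ n := by
        gcongr
        · linarith [abs_nonneg (coeff 0 p)]
        · linarith

variable {g : ℝ → ℝ} {p : PowerSeries ℝ}

lemma const_mul (hg : HasExpansion g p) (c : ℝ) : HasExpansion (fun t => c * g t) (C c * p) :=
  (const c).mul hg

lemma sub {h : ℝ → ℝ} {q : PowerSeries ℝ} (hg : HasExpansion g p) (hh : HasExpansion h q) :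
    HasExpansion (fun t => g t - h t) (p - q) := by
  filter_upwards [hg, hh] with t h1 h2
  simpa [mul_sub] using h1.sub h2

lemma euler (hg : HasExpansion g p) : HasExpansion (fun t => t * deriv g t) (X * d⁄dX ℝ p) := by
  simpa using (pow 1).mul hg.derivative

lemma deriv_zero (hg : HasExpansion g p) : deriv g 0 = coeff 1 p := by
  rw [← hg.derivative.eval_zero, ← coeff_zero_eq_constantCoeff_apply, coeff_derivative]
  simp

lemma deriv_deriv_zero (hg : HasExpansion g p) : deriv (deriv g) 0 = 2 * coeff 2 p := by
  rw [hg.derivative.deriv_zero, coeff_derivative]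
  norm_num
  ring

end HasExpansion

namespace PowerSeries

/-- In order `m ≥ 1` the equation determines `m` times the coefficient from lower ones. This
identifies the monomials found by recursion with the exponentials they stand for. -/
lemma eq_of_X_mul_derivative_eq {W p q : PowerSeries ℝ} (hW : constantCoeff W = 0)
    (hp : X * d⁄dX ℝ p = W * p) (hq : X * d⁄dX ℝ q = W * q)
    (h0 : constantCoeff p = constantCoeff q) : p = q := by
  ext m
  induction m using Nat.strong_induction_on with
  | _ m ih =>
    rcases Nat.eq_zero_or_pos m with rfl | hm
    · simpa using h0
    have h1 := congrArg (coeff m) hp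
    have h2 := congrArg (coeff m) hq
    rw [coeff_X_mul_derivative, coeff_mul_of_constantCoeff_eq_zero hW _ hm] at h1 h2
    have : ∑ k ∈ Finset.Ico 1 m, coeff k W * coeff (m - k) p =
        ∑ k ∈ Finset.Ico 1 m, coeff k W * coeff (m - k) q :=
      Finset.sum_congr rfl fun k hk => by
        have := Finset.mem_Ico.1 hk
        rw [ih (m - k) (by omega)]
    rw [this, h0, ← h2] at h1
    exact mul_left_cancel₀ (by positivity) h1

end PowerSeries

namespace SingularSystem

open PowerSeries

variable {ι α : Type*} [Fintype ι]

lemma expansion_left {S : SingularSystem ι α} {φ : ι → ℝ → ℝ}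
    {P : ι → PowerSeries ℝ} (hφ : ∀ i, HasExpansion (φ i) (P i)) (i : ι) :
    HasExpansion (fun t => t * deriv (fun s => s * deriv (φ i) s) t +
      (t * deriv (φ i) t + S.eps i) * (∑ j, S.mult j * (t * deriv (φ j) t) + S.weight))
    (X * d⁄dX ℝ (X * d⁄dX ℝ (P i)) + (X * d⁄dX ℝ (P i) + C (S.eps i)) *
      (∑ j, C (S.mult j) * (X * d⁄dX ℝ (P j)) + C S.weight)) :=
  (hφ i).euler.euler.add (((hφ i).euler.add (.const _)).mul
    ((HasExpansion.sum _ fun j _ => (hφ j).euler.const_mul _).add (.const _)))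

lemma exists_expansion_monomial {S : SingularSystem ι α} {φ : ι → ℝ → ℝ}
    {P : ι → PowerSeries ℝ} (hφ : ∀ i, HasExpansion (φ i) (P i)) (a : α) :
    ∃ M, HasExpansion (fun t => Real.exp (∑ j, S.expo a j * φ j t)) M ∧
      X * d⁄dX ℝ M = (∑ j, C (S.expo a j) * (X * d⁄dX ℝ (P j))) * M := by
  have han : AnalyticAt ℝ (fun t => ∑ j, S.expo a j * φ j t) 0 :=
    (HasExpansion.sum _ fun j _ => (hφ j).const_mul (S.expo a j)).analyticAt
  obtain ⟨M, hM⟩ : ∃ M, HasExpansion (fun t => Real.exp (∑ j, S.expo a j * φ j t)) M :=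
    HasExpansion.exists_of_analyticAt han.rexp
  refine ⟨M, hM, hM.euler.unique
    ((HasExpansion.sum _ fun j _ => (hφ j).euler.const_mul _).mul hM) ?_⟩
  have hd : ∀ᶠ t in 𝓝 (0 : ℝ), ∀ j, DifferentiableAt ℝ (φ j) t :=
    eventually_all.2 fun j => (hφ j).analyticAt.eventually_analyticAt.mono
      fun t ht => ht.differentiableAt
  filter_upwards [hd.filter_mono nhdsWithin_le_nhds] with t ht
  have h1 : HasDerivAt (fun t => ∑ j, S.expo a j * φ j t)
      (∑ j, S.expo a j * deriv (φ j) t) t :=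
    HasDerivAt.fun_sum fun j _ => (ht j).hasDerivAt.const_mul _
  rw [h1.exp.deriv, Finset.sum_mul, Finset.mul_sum, Finset.mul_sum]
  exact Finset.sum_congr rfl fun j _ => by ring

variable [Fintype α] (S : SingularSystem ι α)

/-- Functions `φ`, analytic at `0`, for which `V_i = t φ_i'` and `Mₐ = exp (∑ γ_{aj} φ_j)` solve
the singular system for small `t > 0`. -/
structure IsLogSolution (φ : ι → ℝ → ℝ) : Prop where
  analyticAt : ∀ i, AnalyticAt ℝ (φ i) 0
  deriv_zero : ∀ i, deriv (φ i) 0 = 0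
  equation : ∀ᶠ t in 𝓝[>] (0 : ℝ), ∀ i,
    t * deriv (fun s => s * deriv (φ i) s) t +
      (t * deriv (φ i) t + S.eps i) * (∑ j, S.mult j * (t * deriv (φ j) t) + S.weight) =
    ∑ a, S.coef i a * (t ^ S.shift a * Real.exp (∑ j, S.expo a j * φ j t)) - S.lam * t ^ 2

variable {S} {φ : ι → ℝ → ℝ} {P : ι → PowerSeries ℝ} {M : α → PowerSeries ℝ}

lemma expansion_right (hM : ∀ a, HasExpansion
      (fun t => Real.exp (∑ j, S.expo a j * φ j t)) (M a)) (i : ι) :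
    HasExpansion (fun t => ∑ a, S.coef i a * (t ^ S.shift a *
        Real.exp (∑ j, S.expo a j * φ j t)) - S.lam * t ^ 2)
      (∑ a, C (S.coef i a) * (X ^ S.shift a * M a) - C S.lam * X ^ 2) :=
  (HasExpansion.sum _ fun a _ => ((HasExpansion.pow _).mul (hM a)).const_mul _).sub
    ((HasExpansion.pow 2).const_mul _)

lemma IsLogSolution.exists_series (h : S.IsLogSolution φ)
    (hinit : ∀ a, Real.exp (∑ j, S.expo a j * φ j 0) = S.init a) :
    ∃ (P : ι → PowerSeries ℝ) (M : α → PowerSeries ℝ), (∀ i, HasExpansion (φ i) (P i)) ∧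
      S.IsSeriesSolution (fun i => X * d⁄dX ℝ (P i)) M := by
  choose P hP using fun i => HasExpansion.exists_of_analyticAt (h.analyticAt i)
  choose M hM hM' using exists_expansion_monomial (S := S) hP
  refine ⟨P, M, hP, fun i => by simp, fun a => ?_, hM', fun i => ?_⟩
  · rw [(hM a).eval_zero, hinit]
  · exact (expansion_left hP i).unique (expansion_right hM i) (h.equation.mono fun t ht => ht i)

/-- The coefficient of order `m` of `V_i = t φ_i'` is `m` times that of `φ_i`. In particular its
order-two coefficient is `φ_i''(0)`, so the free datum of the recursion is a second derivative. -/
lemma IsLogSolution.exists_seq (hS : S.Balanced) (h : S.IsLogSolution φ)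
    (hinit : ∀ a, Real.exp (∑ j, S.expo a j * φ j 0) = S.init a) :
    ∃ (P : ι → PowerSeries ℝ) (u : ℕ → (ι → ℝ) × (α → ℝ)), (∀ i, HasExpansion (φ i) (P i)) ∧
      (∀ i m, (u m).1 i = m * coeff m (P i)) ∧ u 0 = (0, S.init) ∧ (u 1).1 = 0 ∧
      ((u 2).1 = fun i => deriv (deriv (φ i)) 0) ∧ ∀ m ≥ 1, S.CoeffEq m u := by
  obtain ⟨P, M, hP, hsol⟩ := h.exists_series hinit
  have key : ∀ i m, coeff m (X * d⁄dX ℝ (P i)) = m * coeff m (P i) := fun i m =>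
    coeff_X_mul_derivative _ _
  refine ⟨P, coeffSeq _ M, hP, key, Prod.ext ?_ ?_, ?_, ?_, (isSeriesSolution_iff hS
    hsol.constantCoeff_left hsol.constantCoeff_right).1 hsol⟩
  · funext i
    simp [coeffSeq]
  · funext a
    simp [coeffSeq, hsol.constantCoeff_right]
  · funext i
    simp [coeffSeq, key, ← (hP i).deriv_zero, h.deriv_zero]
  · funext i
    simp [coeffSeq, key, (hP i).deriv_deriv_zero]

theorem IsLogSolution.indicial_two (hS : S.Balanced) (hshift : ∀ a, S.shift a ≠ 1)
    (h : S.IsLogSolution φ) (hinit : ∀ a, Real.exp (∑ j, S.expo a j * φ j 0) = S.init a) :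
    S.indicial 2 (fun i => deriv (deriv (φ i)) 0) = S.source := by
  obtain ⟨P, u, -, -, h0, h1, h2, hu⟩ := h.exists_seq hS hinit
  rw [← h2]
  exact S.indicial_two_eq_source hshift h0 h1 hu

theorem IsLogSolution.eventuallyEq (hS : S.Balanced)
    (hT : ∀ m ≥ 3, Function.Injective (S.indicial m)) {ψ : ι → ℝ → ℝ}
    (h : S.IsLogSolution φ) (h' : S.IsLogSolution ψ)
    (hinit : ∀ a, Real.exp (∑ j, S.expo a j * φ j 0) = S.init a)
    (h0 : ∀ i, φ i 0 = ψ i 0) (h2 : ∀ i, deriv (deriv (φ i)) 0 = deriv (deriv (ψ i)) 0) (i : ι) :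
    φ i =ᶠ[𝓝 0] ψ i := by
  obtain ⟨P, u, hP, hPu, a0, a1, a2, hu⟩ := h.exists_seq hS hinit
  obtain ⟨Q, w, hQ, hQw, b0, b1, b2, hw⟩ := h'.exists_seq hS (by simpa [h0] using hinit)
  have := S.coeff_seq_unique hT (a0.trans b0.symm) (a1.trans b1.symm)
    (by rw [a2, b2]; exact funext h2) hu hw
  have e : P i = Q i := by
    ext m
    rcases Nat.eq_zero_or_pos m with rfl | hm
    · simp [(hP i).eval_zero, (hQ i).eval_zero, h0]
    · have := (hPu i m).symm.trans ((by rw [this] : (u m).1 i = (w m).1 i).trans (hQw i m))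
      exact mul_left_cancel₀ (by positivity) this
  exact (e ▸ hP i).eventuallyEq (hQ i)

/-- The recursion solves for `V` and `M` formally. Dividing the coefficients of `V_i` by their
orders gives a convergent series for `φ_i`, whose constant term is prescribed. -/
theorem exists_isLogSolution (hS : S.Balanced) (hshift : ∀ a, S.shift a ≠ 1)
    (hT : ∀ m ≥ 3, Function.Surjective (S.indicial m)) {q : ι → ℝ}
    (hq : S.indicial 2 q = S.source) {φ₀ : ι → ℝ}
    (hinit : ∀ a, Real.exp (∑ j, S.expo a j * φ₀ j) = S.init a) :
    ∃ φ : ι → ℝ → ℝ, S.IsLogSolution φ ∧ (∀ i, φ i 0 = φ₀ i) ∧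
      ∀ i, deriv (deriv (φ i)) 0 = q i := by
  obtain ⟨u, h0, h1, h2, hu⟩ := S.exists_coeff_seq hT hshift hq
  obtain ⟨a, R, hb⟩ := exists_coeff_bound hu
  set P : ι → PowerSeries ℝ := fun i =>
    PowerSeries.mk fun m => if m = 0 then φ₀ i else (u m).1 i / m with hPdef
  have hPm : ∀ i, ∀ m ≥ 1, coeff m (P i) = (u m).1 i / m := fun i m hm => by
    rw [hPdef, coeff_mk, if_neg (by omega)]
  have hex : ∀ i, ∃ g, HasExpansion g (P i) := fun i => by
    refine HasExpansion.exists_of_coeff_bound (a := a) (R := R) fun m hm => ?_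
    rw [hPm i m hm, abs_div, Nat.abs_cast]
    refine (div_le_self (abs_nonneg _) ?_).trans ((hb m hm).1 i)
    exact_mod_cast hm
  choose φ hφ using hex
  have hφ0 : ∀ i, φ i 0 = φ₀ i := fun i => by
    rw [← (hφ i).eval_zero, ← coeff_zero_eq_constantCoeff_apply, hPdef, coeff_mk, if_pos rfl]
  choose M hM hM' using exists_expansion_monomial (S := S) hφ
  have hM0 : ∀ a, constantCoeff (M a) = S.init a := fun a => by
    rw [(hM a).eval_zero, ← hinit]
    simp only [hφ0]
  have hseq : ∀ m, (fun i => coeff m (X * d⁄dX ℝ (P i))) = (u m).1 := fun m => by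
    funext i
    rw [coeff_X_mul_derivative]
    rcases Nat.eq_zero_or_pos m with rfl | hm
    · simp [h0]
    · rw [hPm i m hm]
      field_simp
  set N : α → PowerSeries ℝ := fun a => PowerSeries.mk fun m => (u m).2 a with hN
  have hu' : coeffSeq (fun i => X * d⁄dX ℝ (P i)) N = u := by
    funext m
    refine Prod.ext (hseq m) ?_
    funext a
    simp [coeffSeq, hN]
  have hsol : S.IsSeriesSolution (fun i => X * d⁄dX ℝ (P i)) N := by
    refine (isSeriesSolution_iff hS (fun i => by simp) fun a => ?_).2 (hu' ▸ hu)
    rw [hN, ← coeff_zero_eq_constantCoeff_apply, coeff_mk, h0]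
  -- Both the series of `exp (∑ γ_{aj} φ_j)` and the recursively found `N` solve `t M' = (∑ γ_{aj}
  -- V_j) M` with the same initial value.
  have hMN : M = N := funext fun a => eq_of_X_mul_derivative_eq (by simp) (hM' a)
    (hsol.monomial a) ((hM0 a).trans (hsol.constantCoeff_right a).symm)
  refine ⟨φ, ⟨fun i => (hφ i).analyticAt, fun i => ?_, ?_⟩, hφ0, fun i => ?_⟩
  · rw [(hφ i).deriv_zero, hPm i 1 le_rfl, h1]
    simp
  · refine (eventually_all.2 fun i => ?_).filter_mono nhdsWithin_le_nhds
    have := expansion_left (S := S) hφ i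
    rw [hsol.equation i, ← hMN] at this
    exact this.eventuallyEq (expansion_right hM i)
  · rw [(hφ i).deriv_deriv_zero, hPm i 2 (by norm_num), h2]
    push_cast
    ring

end SingularSystem

/-! ### The Model E equations as a singular system -/

namespace ModelE

/-- The dimensions of the isotropy summands. -/
def mult : Vec5 := ![1, 8, 8, 6, 6]

/-- The exponents of `f₁, …, f₅` in the monomials of the Ricci curvature. -/
def expo : Fin 16 → Fin 5 → ℤ :=
  ![![-2, 0, 0, 0, 0], ![2, -4, 0, 0, 0], ![2, 0, -4, 0, 0], ![2, 0, 0, -2, -2],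
    ![-2, 0, 0, 2, -2], ![-2, 0, 0, -2, 2], ![0, -2, 0, 0, 0], ![0, 2, -2, -2, 0],
    ![0, -2, 2, -2, 0], ![0, -2, -2, 2, 0], ![0, 2, -2, 0, -2], ![0, -2, 2, 0, -2],
    ![0, -2, -2, 0, 2], ![0, 0, -2, 0, 0], ![0, 0, 0, -2, 0], ![0, 0, 0, 0, -2]]

/-- The coefficients of the monomials of the Ricci curvature. -/
def coef : Fin 5 → Fin 16 → ℝ :=
  ![![24, 2, 2, 12, -12, -12, 0, 0, 0, 0, 0, 0, 0, 0, 0, 0],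
    ![0, -1 / 2, 0, 0, 0, 0, 32, 3, -3, -3, 3, -3, -3, 0, 0, 0],
    ![0, 0, -1 / 2, 0, 0, 0, 0, -3, 3, -3, -3, 3, -3, 32, 0, 0],
    ![0, 0, 0, -2, 2, -2, 0, -4, -4, 4, 0, 0, 0, 0, 32, 0],
    ![0, 0, 0, -2, -2, 2, 0, 0, 0, 0, -4, -4, 4, 0, 0, 32]]

/-- The monomials of the Ricci curvature. -/
def monomial (u : Vec5) : Fin 16 → ℝ :=
  ![1 / u 0 ^ 2, u 0 ^ 2 / u 1 ^ 4, u 0 ^ 2 / u 2 ^ 4, u 0 ^ 2 / (u 3 ^ 2 * u 4 ^ 2),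
    u 3 ^ 2 / (u 0 ^ 2 * u 4 ^ 2), u 4 ^ 2 / (u 0 ^ 2 * u 3 ^ 2), 1 / u 1 ^ 2,
    u 1 ^ 2 / (u 2 ^ 2 * u 3 ^ 2), u 2 ^ 2 / (u 1 ^ 2 * u 3 ^ 2), u 3 ^ 2 / (u 1 ^ 2 * u 2 ^ 2),
    u 1 ^ 2 / (u 2 ^ 2 * u 4 ^ 2), u 2 ^ 2 / (u 1 ^ 2 * u 4 ^ 2), u 4 ^ 2 / (u 1 ^ 2 * u 2 ^ 2),
    1 / u 2 ^ 2, 1 / u 3 ^ 2, 1 / u 4 ^ 2]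

lemma sum_fin_sixteen (f : Fin 16 → ℝ) : ∑ a, f a = f 0 + f 1 + f 2 + f 3 + f 4 + f 5 + f 6 +
    f 7 + f 8 + f 9 + f 10 + f 11 + f 12 + f 13 + f 14 + f 15 := by
  simp only [Fin.sum_univ_succ]
  simp
  ring_nf

/-- All five equations have the form `(log f_i)'' + (log f_i)' * ∑ d_j (log f_j)' = Ric_i - lam`.
The coefficients 7 and 5 of the squared logarithmic derivatives are `d_i - 1`. -/
lemma einsteinE_iff (lam : ℝ) (u v w : Vec5) :
    EinsteinE lam u v w ↔ ∀ i, w i / u i - (v i / u i) ^ 2 +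
      v i / u i * ∑ j, mult j * (v j / u j) = ∑ a, coef i a * monomial u a - lam := by
  have H5 : ∑ j, mult j * (v j / u j) = v 0 / u 0 + 8 * (v 1 / u 1) + 8 * (v 2 / u 2) +
      6 * (v 3 / u 3) + 6 * (v 4 / u 4) := by
    simp [Fin.sum_univ_five, mult]
  simp only [EinsteinE, H5, sum_fin_sixteen]
  constructor
  · rintro ⟨h0, h1, h2, h3, h4⟩ i
    fin_cases i <;>
      simp only [coef, monomial, Fin.zero_eta, Fin.mk_one, Fin.reduceFinMk, Matrix.cons_val]
    · linear_combination h0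
    · linear_combination h1
    · linear_combination h2
    · linear_combination h3
    · linear_combination h4
  · intro h
    have h0 := h 0
    have h1 := h 1
    have h2 := h 2
    have h3 := h 3
    have h4 := h 4
    simp only [coef, monomial, Matrix.cons_val] at h0 h1 h2 h3 h4
    refine ⟨?_, ?_, ?_, ?_, ?_⟩
    · linear_combination h0
    · linear_combination h1
    · linear_combination h2
    · linear_combination h3
    · linear_combination h4

lemma monomial_eq_prod (u : Vec5) (a : Fin 16) : monomial u a = ∏ j, u j ^ expo a j := by
  have h2 : ∀ x : ℝ, x ^ (2 : ℤ) = x ^ 2 := fun x => zpow_ofNat x 2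
  have h3 : ∀ x : ℝ, x ^ (-2 : ℤ) = (x ^ 2)⁻¹ := fun x => by rw [zpow_neg, h2]
  have h4 : ∀ x : ℝ, x ^ (-4 : ℤ) = (x ^ 4)⁻¹ := fun x => by
    rw [zpow_neg]; exact congrArg _ (zpow_ofNat x 4)
  rw [Fin.prod_univ_five]
  fin_cases a <;> simp [monomial, expo, h2, h3, h4, div_eq_mul_inv] <;> ring

lemma monomial_exp (ε : Fin 5 → ℕ) {t : ℝ} (ht : t ≠ 0) (x : Vec5) (a : Fin 16) :
    monomial (fun i => t ^ ε i * Real.exp (x i)) a =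
      t ^ (∑ j, ε j * expo a j : ℤ) * Real.exp (∑ j, (expo a j : ℝ) * x j) := by
  rw [monomial_eq_prod]
  simp only [mul_zpow, Finset.prod_mul_distrib, Real.exp_sum]
  congr 1
  · simp only [← zpow_natCast, ← zpow_mul, Fin.prod_univ_five, Fin.sum_univ_five, zpow_add₀ ht]
  · refine Finset.prod_congr rfl fun j _ => ?_
    rw [← Real.rpow_intCast, ← Real.exp_mul, mul_comm]

/-- The singular system of the Model E equations at a singular orbit where `f_i = t ^ ε_i exp φ_i`
with `exp (φ_i 0) = c_i`. -/
def singularSystem (lam : ℝ) (ε : Fin 5 → ℕ) (c : Vec5) : SingularSystem (Fin 5) (Fin 16) where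
  eps i := ε i
  mult := mult
  coef := coef
  expo a j := expo a j
  -- The 2 comes from multiplying the equations by `t ^ 2`. At both orbits the integer is
  -- nonnegative (`epsZero_spec`, `epsOne_spec`), so `toNat` loses nothing.
  shift a := (2 + ∑ j, ε j * expo a j).toNat
  init := monomial c
  lam := lam

/-- The metric functions with logarithmic variables `φ`. -/
def ofLog (ε : Fin 5 → ℕ) (φ : Fin 5 → ℝ → ℝ) (t : ℝ) : Vec5 :=
  fun i => t ^ ε i * Real.exp (φ i t)

lemma exp_sum_expo_mul_log {c : Vec5} (hc : ∀ i, 0 < c i) (a : Fin 16) :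
    Real.exp (∑ j, (expo a j : ℝ) * Real.log (c j)) = monomial c a := by
  have := monomial_exp (fun _ => 0) one_ne_zero (fun i => Real.log (c i)) a
  simp only [pow_zero, one_mul, one_zpow, Real.exp_log (hc _)] at this
  exact this.symm

variable {lam : ℝ} {ε : Fin 5 → ℕ} {φ : Fin 5 → ℝ → ℝ}

lemma hasDerivAt_pow_mul_exp {n : ℕ} {ψ : ℝ → ℝ} {t : ℝ} (ht : t ≠ 0)
    (hψ : DifferentiableAt ℝ ψ t) :
    HasDerivAt (fun s => s ^ n * Real.exp (ψ s))
      (t ^ n * Real.exp (ψ t) * (n / t + deriv ψ t)) t := by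
  refine HasDerivAt.congr_deriv (f' := n * t ^ (n - 1) * Real.exp (ψ t) +
    t ^ n * (Real.exp (ψ t) * deriv ψ t)) ((hasDerivAt_pow n t).mul hψ.hasDerivAt.exp) ?_
  cases n with
  | zero => simp
  | succ n =>
    field_simp
    simp [pow_succ]
    ring

lemma hasDerivAt_id_mul {h : ℝ → ℝ} {h' t : ℝ} (hh : HasDerivAt h h' t) :
    HasDerivAt (fun s => s * h s) (h t + t * h') t :=
  HasDerivAt.congr_deriv (f' := 1 * h t + t * h') ((hasDerivAt_id t).mul hh) (by ring)

/-- Here `(log f_i)' = ε_i / t + φ_i'`. After multiplication by `t ^ 2`, the term `-ε_i` from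
differentiating `ε_i / t` and the discrepancy between `t ^ 2 φ_i''` and `t (t φ_i')'` together
produce the `-1` in `weight`. -/
lemma eventually_einsteinE_iff (c : Vec5) (hε : ∀ a, 0 ≤ 2 + ∑ j, ε j * expo a j)
    (hφ : ∀ i, AnalyticAt ℝ (φ i) 0) :
    ∀ᶠ t in 𝓝[>] (0 : ℝ), EinsteinE lam (ofLog ε φ t) (deriv (ofLog ε φ) t)
        (deriv (deriv (ofLog ε φ)) t) ↔
      ∀ i, t * deriv (fun s => s * deriv (φ i) s) t +
        (t * deriv (φ i) t + (singularSystem lam ε c).eps i) *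
          (∑ j, (singularSystem lam ε c).mult j * (t * deriv (φ j) t) +
            (singularSystem lam ε c).weight) =
        ∑ a, (singularSystem lam ε c).coef i a * (t ^ (singularSystem lam ε c).shift a *
          Real.exp (∑ j, (singularSystem lam ε c).expo a j * φ j t)) -
          (singularSystem lam ε c).lam * t ^ 2 := by
  have han : ∀ᶠ t in 𝓝 (0 : ℝ), ∀ i, AnalyticAt ℝ (φ i) t :=
    eventually_all.2 fun i => (hφ i).eventually_analyticAt
  filter_upwards [self_mem_nhdsWithin, han.eventually_nhds.filter_mono nhdsWithin_le_nhds]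
    with t ht han
  have ht : 0 < t := ht
  have ht0 : t ≠ 0 := ht.ne'
  have hpos : ∀ i, ofLog ε φ t i ≠ 0 := fun i => by
    simp only [ofLog]
    positivity
  have hd1 : ∀ᶠ s in 𝓝 t, HasDerivAt (ofLog ε φ)
      (fun i => ofLog ε φ s i * (ε i / s + deriv (φ i) s)) s := by
    filter_upwards [han, eventually_ne_nhds ht0] with s hs hs0
    exact hasDerivAt_pi.2 fun i => hasDerivAt_pow_mul_exp hs0 (hs i).differentiableAt
  have hd : deriv (ofLog ε φ) =ᶠ[𝓝 t]
      fun s i => ofLog ε φ s i * (ε i / s + deriv (φ i) s) := hd1.mono fun s hs => hs.deriv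
  have han' : ∀ i, DifferentiableAt ℝ (deriv (φ i)) t := fun i =>
    (han.self_of_nhds i).deriv.differentiableAt
  have hdd : deriv (deriv (ofLog ε φ)) t = fun i => ofLog ε φ t i *
      ((ε i / t + deriv (φ i) t) ^ 2 + (-(ε i : ℝ) / t ^ 2 + deriv (deriv (φ i)) t)) := by
    rw [hd.deriv_eq]
    refine (hasDerivAt_pi.2 fun i => ?_).deriv
    have h1 := hasDerivAt_pi.1 hd1.self_of_nhds i
    have h2 : HasDerivAt (fun s : ℝ => (ε i : ℝ) / s) (-(ε i : ℝ) / t ^ 2) t := by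
      simpa [div_eq_mul_inv] using (hasDerivAt_inv ht0).const_mul (ε i : ℝ)
    refine (h1.mul (h2.add (han' i).hasDerivAt)).congr_deriv ?_
    simp only [Pi.add_apply]
    ring
  have hV : ∀ i, deriv (fun s => s * deriv (φ i) s) t =
      deriv (φ i) t + t * deriv (deriv (φ i)) t := fun i => by
    exact (hasDerivAt_id_mul (han' i).hasDerivAt).deriv
  have hmon : ∀ a, t ^ 2 * monomial (ofLog ε φ t) a =
      t ^ (2 + ∑ j, ε j * expo a j).toNat * Real.exp (∑ j, (expo a j : ℝ) * φ j t) := fun a => by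
    have := monomial_exp ε ht0 (fun i => φ i t) a
    change monomial (ofLog ε φ t) a = _ at this
    rw [this, ← mul_assoc, ← zpow_natCast t (Int.toNat _), Int.toNat_of_nonneg (hε a),
      zpow_add₀ ht0]
    rfl
  rw [einsteinE_iff, hdd, hd.self_of_nhds]
  refine forall_congr' fun i => ?_
  simp only [mul_div_cancel_left₀ _ (hpos _), hV, singularSystem, SingularSystem.weight, ← hmon]
  have e1 : ∑ j, mult j * (ε j / t + deriv (φ j) t) =
      (∑ j, mult j * (t * deriv (φ j) t) + ∑ j, mult j * ε j) / t := by
    rw [← Finset.sum_add_distrib, Finset.sum_div]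
    refine Finset.sum_congr rfl fun j _ => ?_
    field_simp
    ring
  have e2 : ∑ a, coef i a * (t ^ 2 * monomial (ofLog ε φ t) a) =
      t ^ 2 * ∑ a, coef i a * monomial (ofLog ε φ t) a := by
    rw [Finset.mul_sum]
    exact Finset.sum_congr rfl fun a _ => by ring
  rw [e1, e2, ← mul_right_inj' (pow_ne_zero 2 ht0)]
  set A := ∑ j, mult j * (t * deriv (φ j) t)
  set B := ∑ j, mult j * (ε j : ℝ)
  set D := ∑ a, coef i a * monomial (ofLog ε φ t) a
  have e3 : t ^ 2 * ((ε i / t + deriv (φ i) t) ^ 2 + (-(ε i : ℝ) / t ^ 2 + deriv (deriv (φ i)) t) -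
      (ε i / t + deriv (φ i) t) ^ 2 + (ε i / t + deriv (φ i) t) * ((A + B) / t)) =
      t * (deriv (φ i) t + t * deriv (deriv (φ i)) t) +
        (t * deriv (φ i) t + ε i) * (A + (B - 1)) := by
    field_simp
    ring
  rw [e3, mul_sub, mul_comm (t ^ 2) lam]

/-! ### Smoothness conditions in logarithmic variables -/

/-- Solutions with analytic continuation beyond the singular orbit at `t = 0`, where the functions
with `ε_i = 1` vanish with slope `c_i` and the others have the value `c_i`. -/
structure IsSmoothSolution (lam : ℝ) (ε : Fin 5 → ℕ) (c : Vec5) (g : ℝ → Vec5) : Prop where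
  analyticAt : AnalyticAt ℝ g 0
  einstein : ∀ᶠ t in 𝓝[>] (0 : ℝ), EinsteinE lam (g t) (deriv g t) (deriv (deriv g) t)
  value : ∀ i, g 0 i = if ε i = 0 then c i else 0
  slope : ∀ i, deriv g 0 i = if ε i = 0 then 0 else c i
  second : ∀ i, ε i ≠ 0 → deriv (deriv g) 0 i = 0

lemma deriv_apply_of_analyticAt {g : ℝ → Vec5} {t : ℝ} (hg : AnalyticAt ℝ g t) (i : Fin 5) :
    deriv g t i = deriv (fun s => g s i) t :=
  ((hasDerivAt_pi.1 hg.differentiableAt.hasDerivAt i).deriv).symm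

lemma deriv_deriv_apply_of_analyticAt {g : ℝ → Vec5} {t : ℝ} (hg : AnalyticAt ℝ g t) (i : Fin 5) :
    deriv (deriv g) t i = deriv (deriv fun s => g s i) t := by
  rw [deriv_apply_of_analyticAt hg.deriv]
  refine EventuallyEq.deriv_eq ?_
  filter_upwards [hg.eventually_analyticAt] with s hs
  exact deriv_apply_of_analyticAt hs i

lemma exists_log_of_pos {g : ℝ → ℝ} {c : ℝ} (hc : 0 < c) (hg : AnalyticAt ℝ g 0) (h0 : g 0 = c)
    (h1 : deriv g 0 = 0) : ∃ ψ : ℝ → ℝ, AnalyticAt ℝ ψ 0 ∧ ψ 0 = Real.log c ∧ deriv ψ 0 = 0 ∧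
      g =ᶠ[𝓝 0] fun t => Real.exp (ψ t) := by
  refine ⟨fun t => Real.log (g t), hg.log (by rw [h0]; exact hc), by simp [h0], ?_, ?_⟩
  · rw [deriv.log hg.differentiableAt (by rw [h0]; exact hc.ne'), h1, zero_div]
  · have : ∀ᶠ t in 𝓝 (0 : ℝ), 0 < g t :=
      hg.continuousAt.eventually (lt_mem_nhds (by rw [h0]; exact hc))
    filter_upwards [this] with t ht
    rw [Real.exp_log ht]

lemma deriv_deriv_id_mul {h : ℝ → ℝ} (hh : AnalyticAt ℝ h 0) :
    deriv (fun t => t * h t) 0 = h 0 ∧ deriv (deriv fun t => t * h t) 0 = 2 * deriv h 0 := by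
  have h1 : ∀ᶠ t in 𝓝 (0 : ℝ), deriv (fun t => t * h t) t = h t + t * deriv h t := by
    filter_upwards [hh.eventually_analyticAt] with t ht
    exact (hasDerivAt_id_mul ht.differentiableAt.hasDerivAt).deriv
  refine ⟨by simpa using h1.self_of_nhds, ?_⟩
  rw [EventuallyEq.deriv_eq h1]
  refine (hh.differentiableAt.hasDerivAt.add
    (hasDerivAt_id_mul hh.deriv.differentiableAt.hasDerivAt)).deriv.trans ?_
  ring

/-- Since `g` vanishes at 0, `g = t h` with `h = dslope g 0` analytic. Then `g''(0) = 2 h'(0)`, so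
the second-order condition is what makes the derivative of `log h` vanish at 0. -/
lemma exists_log_of_slope {g : ℝ → ℝ} {c : ℝ} (hc : 0 < c) (hg : AnalyticAt ℝ g 0) (h0 : g 0 = 0)
    (h1 : deriv g 0 = c) (h2 : deriv (deriv g) 0 = 0) : ∃ ψ : ℝ → ℝ, AnalyticAt ℝ ψ 0 ∧
      ψ 0 = Real.log c ∧ deriv ψ 0 = 0 ∧ g =ᶠ[𝓝 0] fun t => t * Real.exp (ψ t) := by
  have hh : AnalyticAt ℝ (dslope g 0) 0 := by
    obtain ⟨p, hp⟩ := hg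
    exact ⟨_, hp.has_fpower_series_dslope_fslope⟩
  have hg' : g = fun t => t * dslope g 0 t := by
    funext t
    have := sub_smul_dslope g 0 t
    simp only [sub_zero, h0, smul_eq_mul] at this
    exact this.symm
  have hd := deriv_deriv_id_mul hh
  rw [← hg', h1, h2] at hd
  obtain ⟨ψ, a1, a2, a3, a4⟩ := exists_log_of_pos hc hh hd.1.symm (by linarith [hd.2])
  refine ⟨ψ, a1, a2, a3, ?_⟩
  filter_upwards [a4] with t ht
  rw [← ht]
  exact congrFun hg' t

lemma IsSmoothSolution.congr {c : Vec5} {g g' : ℝ → Vec5} (hg : IsSmoothSolution lam ε c g)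
    (e : g =ᶠ[𝓝 0] g') : IsSmoothSolution lam ε c g' := by
  refine ⟨hg.analyticAt.congr e, ?_, ?_, ?_, ?_⟩
  · filter_upwards [hg.einstein, e.eventuallyEq_nhds.filter_mono nhdsWithin_le_nhds,
      e.deriv.deriv.filter_mono nhdsWithin_le_nhds,
      e.deriv.filter_mono nhdsWithin_le_nhds] with t h1 h2 h3 h4
    rwa [← h2.self_of_nhds, ← h3, ← h4]
  · rw [← e.self_of_nhds]
    exact hg.value
  · rw [← e.deriv_eq]
    exact hg.slope
  · rw [← e.deriv.deriv_eq]
    exact hg.second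

lemma IsSmoothSolution.exists_log {c : Vec5} {g : ℝ → Vec5} (hε : ∀ i, ε i = 0 ∨ ε i = 1)
    (hε' : ∀ a, 0 ≤ 2 + ∑ j, ε j * expo a j)
    (hc : ∀ i, 0 < c i) (hg : IsSmoothSolution lam ε c g) :
    ∃ φ, (singularSystem lam ε c).IsLogSolution φ ∧ (∀ i, φ i 0 = Real.log (c i)) ∧
      g =ᶠ[𝓝 0] ofLog ε φ := by
  have hi : ∀ i, AnalyticAt ℝ (fun t => g t i) 0 := fun i => analyticAt_pi_iff.1 hg.analyticAt i
  have : ∀ i, ∃ ψ : ℝ → ℝ, AnalyticAt ℝ ψ 0 ∧ ψ 0 = Real.log (c i) ∧ deriv ψ 0 = 0 ∧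
      (fun t => g t i) =ᶠ[𝓝 0] fun t => t ^ ε i * Real.exp (ψ t) := by
    intro i
    have hv := hg.value i
    have hs := hg.slope i
    rw [deriv_apply_of_analyticAt hg.analyticAt] at hs
    rcases hε i with h | h
    · rw [if_pos h] at hv hs
      simpa [h] using exists_log_of_pos (hc i) (hi i) hv hs
    · rw [if_neg (by omega)] at hv hs
      have h2 := hg.second i (by omega)
      rw [deriv_deriv_apply_of_analyticAt hg.analyticAt] at h2
      simpa [h] using exists_log_of_slope (hc i) (hi i) hv hs h2
  choose φ h1 h2 h3 h4 using this
  have e : g =ᶠ[𝓝 0] ofLog ε φ := by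
    filter_upwards [eventually_all.2 h4] with t ht
    exact funext ht
  refine ⟨φ, ⟨h1, h3, ?_⟩, h2, e⟩
  filter_upwards [(hg.congr e).einstein, eventually_einsteinE_iff (lam := lam) c hε' h1]
    with t a1 a2
  exact a2.1 a1

lemma isSmoothSolution_ofLog {c : Vec5} (hε : ∀ i, ε i = 0 ∨ ε i = 1)
    (hε' : ∀ a, 0 ≤ 2 + ∑ j, ε j * expo a j) (hc : ∀ i, 0 < c i)
    (hφ : (singularSystem lam ε c).IsLogSolution φ) (h0 : ∀ i, φ i 0 = Real.log (c i)) :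
    IsSmoothSolution lam ε c (ofLog ε φ) := by
  have han : AnalyticAt ℝ (ofLog ε φ) 0 := analyticAt_pi_iff.2 fun i =>
    (analyticAt_id.pow _).mul (hφ.analyticAt i).rexp
  have hexp : ∀ i, deriv (fun t => Real.exp (φ i t)) 0 = 0 := fun i => by
    rw [((hφ.analyticAt i).differentiableAt.hasDerivAt.exp).deriv, hφ.deriv_zero, mul_zero]
  have hexpa : ∀ i, AnalyticAt ℝ (fun t => Real.exp (φ i t)) 0 := fun i =>
    (hφ.analyticAt i).rexp
  have hd : ∀ i, ε i ≠ 0 → (fun t => ofLog ε φ t i) = fun t => t * Real.exp (φ i t) := by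
    intro i hi
    have : ε i = 1 := (hε i).resolve_left hi
    simp [ofLog, this]
  refine ⟨han, ?_, fun i => ?_, fun i => ?_, fun i hi => ?_⟩
  · filter_upwards [hφ.equation, eventually_einsteinE_iff (lam := lam) c hε' hφ.analyticAt]
      with t a1 a2
    exact a2.2 a1
  · rcases hε i with h | h <;> simp [ofLog, h, h0, Real.exp_log (hc i)]
  · rw [deriv_apply_of_analyticAt han]
    split_ifs with h
    · simpa [ofLog, h] using hexp i
    · rw [hd i h, (deriv_deriv_id_mul (hexpa i)).1, h0, Real.exp_log (hc i)]
  · rw [deriv_deriv_apply_of_analyticAt han, hd i hi,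
      (deriv_deriv_id_mul (hexpa i)).2, hexp, mul_zero]

end ModelE

/-! ### Second-order terms and the family of smooth solutions -/

lemma HasExpansion.isLittleO_sub {g : ℝ → ℝ} {p : PowerSeries ℝ} (hg : HasExpansion g p) :
    (fun t => g t - (g 0 + deriv g 0 * t + deriv (deriv g) 0 / 2 * t ^ 2)) =o[𝓝 0]
      fun t : ℝ => t ^ 2 := by
  have h := (HasExpansion.iff_hasFPowerSeriesAt.1 hg).isBigO_sub_partialSum_pow 3
  have h3 : (fun t : ℝ => ‖t‖ ^ 3) =o[𝓝 0] fun t : ℝ => t ^ 2 := by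
    have := (isLittleO_pow_pow (𝕜 := ℝ) (by norm_num : 2 < 3)).norm_left
    simpa using this
  refine (h.trans_isLittleO h3).congr_left fun t => ?_
  rw [hg.deriv_zero, hg.deriv_deriv_zero, ← hg.eval_zero]
  simp [FormalMultilinearSeries.partialSum, Finset.sum_range_succ, FormalMultilinearSeries.ofScalars]

namespace ModelE

variable {lam : ℝ} {ε : Fin 5 → ℕ} {c : Vec5}

/-- The second order expansion `f_i ^ 2 / t ^ (2 ε_i) = c_i ^ 2 (1 + q_i t ^ 2) + o(t ^ 2)`. -/
def HasSecondOrder (ε : Fin 5 → ℕ) (c : Vec5) (g : ℝ → Vec5) (q : Vec5) : Prop :=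
  ∀ i, (fun t => g t i ^ 2 / (t ^ ε i) ^ 2 - c i ^ 2 - t ^ 2 * (c i ^ 2 * q i)) =o[𝓝[>] 0]
    fun t : ℝ => t ^ 2

lemma HasSecondOrder.congr {g g' : ℝ → Vec5} {q : Vec5} (hg : HasSecondOrder ε c g q)
    (e : g =ᶠ[𝓝[>] 0] g') : HasSecondOrder ε c g' q := fun i =>
  (hg i).congr' (e.mono fun t ht => by simp only [ht]) EventuallyEq.rfl

lemma HasSecondOrder.unique (hc : ∀ i, 0 < c i) {g : ℝ → Vec5} {q q' : Vec5}
    (hq : HasSecondOrder ε c g q) (hq' : HasSecondOrder ε c g q') : q = q' := by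
  funext i
  have h1 : (fun t : ℝ => (c i ^ 2 * (q' i - q i)) * t ^ 2) =o[𝓝[>] 0] fun t : ℝ => t ^ 2 :=
    ((hq i).sub (hq' i)).congr_left fun t => by ring
  by_contra hne
  have hk : c i ^ 2 * (q' i - q i) ≠ 0 :=
    mul_ne_zero (pow_ne_zero 2 (hc i).ne') (sub_ne_zero.2 (Ne.symm hne))
  have h2 := (isLittleO_const_mul_left_iff hk).1 h1
  refine isLittleO_irrefl (Eventually.frequently ?_) h2
  filter_upwards [self_mem_nhdsWithin] with t ht
  exact pow_ne_zero 2 (ne_of_gt ht)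

/-- Dividing by `t ^ (2 ε_i)` leaves `exp (2 φ_i)`. As `φ_i'(0) = 0`, its second derivative at 0 is
`2 c_i ^ 2 φ_i''(0)`, and Taylor's formula halves it. -/
lemma hasSecondOrder_ofLog {φ : Fin 5 → ℝ → ℝ} (hc : ∀ i, 0 < c i)
    (hφ : ∀ i, AnalyticAt ℝ (φ i) 0) (h0 : ∀ i, φ i 0 = Real.log (c i))
    (h1 : ∀ i, deriv (φ i) 0 = 0) :
    HasSecondOrder ε c (ofLog ε φ) fun i => deriv (deriv (φ i)) 0 := by
  intro i
  have hX : AnalyticAt ℝ (fun t => Real.exp (φ i t) ^ 2) 0 := (hφ i).rexp.pow 2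
  obtain ⟨p, hp⟩ := HasExpansion.exists_of_analyticAt hX
  have d1 : ∀ᶠ t in 𝓝 (0 : ℝ), deriv (fun t => Real.exp (φ i t) ^ 2) t =
      2 * Real.exp (φ i t) ^ 2 * deriv (φ i) t := by
    filter_upwards [(hφ i).eventually_analyticAt] with t ht
    refine (ht.differentiableAt.hasDerivAt.exp.pow 2).deriv.trans ?_
    simp
    ring
  have d2 : deriv (deriv fun t => Real.exp (φ i t) ^ 2) 0 =
      2 * c i ^ 2 * deriv (deriv (φ i)) 0 := by
    rw [EventuallyEq.deriv_eq d1]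
    refine (((hX.differentiableAt.hasDerivAt.const_mul 2).mul
      (hφ i).deriv.differentiableAt.hasDerivAt).deriv).trans ?_
    rw [h1, h0, Real.exp_log (hc i)]
    ring
  have := hp.isLittleO_sub
  rw [d2, d1.self_of_nhds, h1, h0, Real.exp_log (hc i)] at this
  refine (this.mono nhdsWithin_le_nhds).congr' ?_ EventuallyEq.rfl
  filter_upwards [self_mem_nhdsWithin] with t ht
  have ht : t ^ ε i ≠ 0 := pow_ne_zero _ (ne_of_gt ht)
  simp only [ofLog]
  field_simp
  ring

/-- The smooth solutions are parametrized by their second order terms. -/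
theorem exists_family (hε : ∀ i, ε i = 0 ∨ ε i = 1) (hε' : ∀ a, 0 ≤ 2 + ∑ j, ε j * expo a j)
    (hshift : ∀ a, 2 + ∑ j, ε j * expo a j ≠ 1) (hc : ∀ i, 0 < c i)
    (hS : (singularSystem lam ε c).Balanced)
    (hT : ∀ m ≥ 3, ∀ v, (singularSystem lam ε c).indicial m v = 0 → v = 0) :
    ∃ G : {q // (singularSystem lam ε c).indicial 2 q = (singularSystem lam ε c).source} →
        ℝ → Vec5,
      (∀ q, IsSmoothSolution lam ε c (G q)) ∧ (∀ q, HasSecondOrder ε c (G q) q) ∧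
      ∀ g, IsSmoothSolution lam ε c g → ∃ q, g =ᶠ[𝓝 0] G q := by
  have hshift' : ∀ a, (singularSystem lam ε c).shift a ≠ 1 := fun a h => hshift a (by
    have h1 : (2 + ∑ j, ε j * expo a j).toNat = 1 := h
    have := hε' a
    omega)
  have hinj : ∀ m ≥ 3, Function.Injective ((singularSystem lam ε c).indicial m) := fun m hm =>
    (injective_iff_map_eq_zero _).2 (hT m hm)
  have hsurj : ∀ m ≥ 3, Function.Surjective ((singularSystem lam ε c).indicial m) := fun m hm =>
    LinearMap.injective_iff_surjective.1 (hinj m hm)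
  choose φ hφ h0 h2 using fun q : {q // (singularSystem lam ε c).indicial 2 q =
      (singularSystem lam ε c).source} => SingularSystem.exists_isLogSolution hS hshift' hsurj q.2
      (φ₀ := fun j => Real.log (c j)) (exp_sum_expo_mul_log hc)
  refine ⟨fun q => ofLog ε (φ q), fun q => isSmoothSolution_ofLog hε hε' hc (hφ q) (h0 q),
    fun q => ?_, fun g hg => ?_⟩
  · have := hasSecondOrder_ofLog (ε := ε) hc (hφ q).analyticAt (h0 q) (hφ q).deriv_zero
    rwa [funext (h2 q)] at this
  · obtain ⟨ψ, hψ, hψ0, e⟩ := hg.exists_log hε hε' hc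
    have hinit : ∀ a, Real.exp (∑ j, (singularSystem lam ε c).expo a j * ψ j 0) =
        (singularSystem lam ε c).init a := fun a => by
      simp only [hψ0]
      exact exp_sum_expo_mul_log hc a
    refine ⟨⟨_, hψ.indicial_two hS hshift' hinit⟩, e.trans ?_⟩
    have := fun i => hψ.eventuallyEq hS hinj (hφ ⟨_, hψ.indicial_two hS hshift' hinit⟩) hinit
      (fun i => by rw [hψ0, h0]) (fun i => by rw [h2]) i
    filter_upwards [eventually_all.2 this] with t ht
    funext i
    simp only [ofLog, ht]

/-! ### Explicit indicial operators at the two singular orbits -/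

/-- The vanishing functions at `t = 0`. -/
def epsZero : Fin 5 → ℕ := ![1, 1, 0, 0, 0]

/-- The leading coefficients at `t = 0`. -/
def leadZero (ζ : ℝ) : Vec5 := ![4, Real.sqrt 2, ζ, ζ, ζ]

/-- The vanishing functions at `t = 1`. -/
def epsOne : Fin 5 → ℕ := ![0, 0, 0, 1, 0]

/-- The leading coefficients at `t = 1`. -/
def leadOne (ζ ξ : ℝ) : Vec5 := ![ζ, ξ, ξ, 2, ζ]

lemma shift_zero (lam : ℝ) (c : Vec5) : (singularSystem lam epsZero c).shift =
    ![0, 0, 4, 4, 0, 0, 0, 4, 0, 0, 4, 0, 0, 2, 2, 2] := by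
  funext a
  simp only [singularSystem]
  revert a
  decide

lemma shift_one (lam : ℝ) (c : Vec5) : (singularSystem lam epsOne c).shift =
    ![2, 2, 2, 0, 4, 0, 2, 0, 0, 4, 2, 2, 2, 2, 0, 2] := by
  funext a
  simp only [singularSystem]
  revert a
  decide

lemma weight_zero (lam : ℝ) (c : Vec5) : (singularSystem lam epsZero c).weight = 8 := by
  simp [SingularSystem.weight, singularSystem, Fin.sum_univ_five, epsZero, mult]

lemma weight_one (lam : ℝ) (c : Vec5) : (singularSystem lam epsOne c).weight = 5 := by
  simp [SingularSystem.weight, singularSystem, Fin.sum_univ_five, epsOne, mult]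
  norm_num

lemma sqrt_two_pow_four : Real.sqrt 2 ^ 4 = 4 := by
  rw [show 4 = 2 * 2 from rfl, pow_mul, Real.sq_sqrt (by norm_num)]
  norm_num

lemma monomial_leadZero {ζ : ℝ} (hζ : 0 < ζ) : monomial (leadZero ζ) =
    ![1 / 16, 4, 16 / ζ ^ 4, 16 / ζ ^ 4, 1 / 16, 1 / 16, 1 / 2, 2 / ζ ^ 4, 1 / 2, 1 / 2, 2 / ζ ^ 4,
      1 / 2, 1 / 2, 1 / ζ ^ 2, 1 / ζ ^ 2, 1 / ζ ^ 2] := by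
  have h2 : Real.sqrt 2 ^ 2 = 2 := Real.sq_sqrt (by norm_num)
  funext a
  fin_cases a <;> simp [monomial, leadZero, h2, sqrt_two_pow_four] <;> field_simp <;> norm_num

lemma monomial_leadOne {ζ ξ : ℝ} (hζ : 0 < ζ) (hξ : 0 < ξ) : monomial (leadOne ζ ξ) =
    ![1 / ζ ^ 2, ζ ^ 2 / ξ ^ 4, ζ ^ 2 / ξ ^ 4, 1 / 4, 4 / ζ ^ 4, 1 / 4, 1 / ξ ^ 2, 1 / 4, 1 / 4,
      4 / ξ ^ 4, 1 / ζ ^ 2, 1 / ζ ^ 2, ζ ^ 2 / ξ ^ 4, 1 / ξ ^ 2, 1 / 4, 1 / ζ ^ 2] := by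
  funext a
  fin_cases a <;> simp [monomial, leadOne] <;> field_simp <;> norm_num

lemma balanced_zero (lam : ℝ) {ζ : ℝ} (hζ : 0 < ζ) :
    (singularSystem lam epsZero (leadZero ζ)).Balanced := by
  intro i
  rw [weight_zero, sum_fin_sixteen, shift_zero]
  simp only [singularSystem, monomial_leadZero hζ]
  fin_cases i <;> simp [coef, epsZero] <;> norm_num

lemma balanced_one (lam : ℝ) {ζ ξ : ℝ} (hζ : 0 < ζ) (hξ : 0 < ξ) :
    (singularSystem lam epsOne (leadOne ζ ξ)).Balanced := by
  intro i
  rw [weight_one, sum_fin_sixteen, shift_one]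
  simp only [singularSystem, monomial_leadOne hζ hξ]
  fin_cases i <;> simp [coef, epsOne]
  norm_num

lemma source_zero (lam : ℝ) {ζ : ℝ} (hζ : 0 < ζ) :
    (singularSystem lam epsZero (leadZero ζ)).source =
      ![-lam, -lam, 32 / ζ ^ 2 - lam, 32 / ζ ^ 2 - lam, 32 / ζ ^ 2 - lam] := by
  funext i
  rw [SingularSystem.source, sum_fin_sixteen, shift_zero]
  simp only [singularSystem, monomial_leadZero hζ]
  fin_cases i <;> simp [coef] <;> ring

lemma source_one (lam : ℝ) {ζ ξ : ℝ} (hζ : 0 < ζ) (hξ : 0 < ξ) :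
    (singularSystem lam epsOne (leadOne ζ ξ)).source =
      ![24 / ζ ^ 2 + 4 * (ζ ^ 2 / ξ ^ 4) - lam, 32 / ξ ^ 2 - 7 / 2 * (ζ ^ 2 / ξ ^ 4) - lam,
        32 / ξ ^ 2 - 7 / 2 * (ζ ^ 2 / ξ ^ 4) - lam, - lam,
        24 / ζ ^ 2 + 4 * (ζ ^ 2 / ξ ^ 4) - lam] := by
  funext i
  rw [SingularSystem.source, sum_fin_sixteen, shift_one]
  simp only [singularSystem, monomial_leadOne hζ hξ]
  fin_cases i <;> simp [coef] <;> ring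

lemma indicial_zero (lam : ℝ) {ζ : ℝ} (hζ : 0 < ζ) (m : ℕ) (v : Vec5) :
    (singularSystem lam epsZero (leadZero ζ)).indicial m v =
      ![(m + 8) * v 0 + (v 0 + 8 * v 1 + 8 * v 2 + 6 * v 3 + 6 * v 4) - 2 / m * (8 * v 0 - 16 * v 1),
        (m + 8) * v 1 + (v 0 + 8 * v 1 + 8 * v 2 + 6 * v 3 + 6 * v 4) +
          2 / m * (2 * v 0 + 6 * v 1),
        (m + 8) * v 2 - 2 / m * (6 * v 2 - 3 * v 3 - 3 * v 4),
        (m + 8) * v 3 - 2 / m * (-4 * v 2 + 17 / 4 * v 3 - 1 / 4 * v 4),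
        (m + 8) * v 4 - 2 / m * (-4 * v 2 - 1 / 4 * v 3 + 17 / 4 * v 4)] := by
  funext i
  simp only [SingularSystem.indicial, LinearMap.coe_mk, AddHom.coe_mk]
  rw [weight_zero, sum_fin_sixteen, shift_zero]
  simp only [singularSystem, monomial_leadZero hζ, Fin.sum_univ_five]
  fin_cases i <;> simp [coef, expo, epsZero, mult] <;> ring

lemma indicial_one (lam : ℝ) {ζ ξ : ℝ} (hζ : 0 < ζ) (hξ : 0 < ξ) (m : ℕ) (v : Vec5) :
    (singularSystem lam epsOne (leadOne ζ ξ)).indicial m v =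
      ![(m + 5) * v 0 - 2 / m * (6 * v 0 - 6 * v 4),
        (m + 5) * v 1 - 2 / m * (3 / 2 * v 1 - 3 / 2 * v 2),
        (m + 5) * v 2 - 2 / m * (3 / 2 * v 2 - 3 / 2 * v 1),
        (m + 5) * v 3 + (v 0 + 8 * v 1 + 8 * v 2 + 6 * v 3 + 6 * v 4) + 2 / m * (5 * v 3),
        (m + 5) * v 4 - 2 / m * (v 4 - v 0)] := by
  funext i
  simp only [SingularSystem.indicial, LinearMap.coe_mk, AddHom.coe_mk]
  rw [weight_one, sum_fin_sixteen, shift_one]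
  simp only [singularSystem, monomial_leadOne hζ hξ, Fin.sum_univ_five]
  fin_cases i <;> simp [coef, expo, epsOne, mult] <;> ring

/-- The last three coordinates decouple: `v 3 - v 4` and `v 2 - v 3` are killed in turn by `(x -
1)(x + 9)` and `(x - 2)(x + 10)`. What remains is a two-by-two block for `v 0` and `v 1`. -/
lemma eq_zero_of_indicial_zero (lam : ℝ) {ζ : ℝ} (hζ : 0 < ζ) {m : ℕ} (hm : 3 ≤ m) {v : Vec5}
    (h : (singularSystem lam epsZero (leadZero ζ)).indicial m v = 0) : v = 0 := by
  rw [indicial_zero lam hζ] at h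
  have hm3 : (3 : ℝ) ≤ m := by exact_mod_cast hm
  generalize (m : ℝ) = x at h hm3
  have hx : x ≠ 0 := by linarith
  have h0 := congrFun h 0
  have h1 := congrFun h 1
  have h2 := congrFun h 2
  have h3 := congrFun h 3
  have h4 := congrFun h 4
  simp only [Matrix.cons_val, Pi.zero_apply] at h0 h1 h2 h3 h4
  field_simp at h0 h1 h2 h3 h4
  have k1 : (x * (x + 8) - 9) * (v 3 - v 4) = 0 := by linear_combination (h3 - h4) / 4
  have k1' : v 3 = v 4 := sub_eq_zero.1 ((mul_eq_zero.1 k1).resolve_left (by nlinarith))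
  have k2 : (x * (x + 8) - 20) * (v 2 - v 3) = 0 := by
    rw [← k1'] at h2 h3
    linear_combination h2 - h3 / 4
  have k2' : v 2 = v 3 := sub_eq_zero.1 ((mul_eq_zero.1 k2).resolve_left (by nlinarith))
  rw [← k1', k2'] at h2
  have k3 : x * (x + 8) * v 3 = 0 := by linear_combination h2
  have k3' : v 3 = 0 := (mul_eq_zero.1 k3).resolve_left (by positivity)
  rw [← k1', k2', k3'] at h0 h1
  -- This determinant of the `(v 0, v 1)` block vanishes at `x = 2`. For `x ≥ 3` its diagonal
  -- product is at least twice the off-diagonal one.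
  have d : 0 < (x * (x + 9) - 16) * (x * (x + 16) + 12) - (x + 4) * 8 * (x + 4) := by
    have a1 : 2 * (x + 4) ≤ x * (x + 9) - 16 := by nlinarith
    have a2 : 8 * (x + 4) ≤ x * (x + 16) + 12 := by nlinarith
    have a3 := mul_le_mul a1 a2 (by linarith) (by linarith)
    nlinarith
  have k4 : v 0 = 0 := by
    refine (mul_eq_zero.1 ?_).resolve_left d.ne'
    linear_combination (x * (x + 16) + 12) * h0 - 8 * (x + 4) * h1
  have k5 : v 1 = 0 := by
    refine (mul_eq_zero.1 ?_).resolve_left d.ne'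
    linear_combination (x * (x + 9) - 16) * h1 - (x + 4) * h0
  have k6 : v 4 = 0 := k1' ▸ k3'
  funext i
  fin_cases i <;> simp [*]

/-- The differences `v 0 - v 4` and `v 1 - v 2` carry the factors `(x - 2)(x + 7)` and `(x - 1)(x +
6)`, nonzero for `x ≥ 3`. All other factors are positive. -/
lemma eq_zero_of_indicial_one (lam : ℝ) {ζ ξ : ℝ} (hζ : 0 < ζ) (hξ : 0 < ξ) {m : ℕ} (hm : 3 ≤ m)
    {v : Vec5} (h : (singularSystem lam epsOne (leadOne ζ ξ)).indicial m v = 0) : v = 0 := by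
  rw [indicial_one lam hζ hξ] at h
  have hm3 : (3 : ℝ) ≤ m := by exact_mod_cast hm
  generalize (m : ℝ) = x at h hm3
  have hx : x ≠ 0 := by linarith
  have h0 := congrFun h 0
  have h1 := congrFun h 1
  have h2 := congrFun h 2
  have h3 := congrFun h 3
  have h4 := congrFun h 4
  simp only [Matrix.cons_val, Pi.zero_apply] at h0 h1 h2 h3 h4
  field_simp at h0 h1 h2 h3 h4
  have k1 : (x * (x + 5) - 14) * (v 0 - v 4) = 0 := by linear_combination h0 - h4
  have k1' : v 0 = v 4 := sub_eq_zero.1 ((mul_eq_zero.1 k1).resolve_left (by nlinarith))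
  have k2 : (x * (x + 5) - 6) * (v 1 - v 2) = 0 := by linear_combination h1 - h2
  have k2' : v 1 = v 2 := sub_eq_zero.1 ((mul_eq_zero.1 k2).resolve_left (by nlinarith))
  have k3 : x * (x + 5) * v 4 = 0 := by rw [k1'] at h4; linear_combination h4
  have k3' : v 4 = 0 := (mul_eq_zero.1 k3).resolve_left (by positivity)
  have k4 : x * (x + 5) * v 2 = 0 := by rw [k2'] at h2; linear_combination h2
  have k4' : v 2 = 0 := (mul_eq_zero.1 k4).resolve_left (by positivity)
  rw [k1', k2', k3', k4'] at h3
  have k5 : (x * (x + 11) + 10) * v 3 = 0 := by linear_combination h3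
  have k5' : v 3 = 0 := (mul_eq_zero.1 k5).resolve_left (by positivity)
  funext i
  fin_cases i <;> simp [*]

/-! ### The operator `𝓛₀` compared with the indicial operator of order two -/

lemma fderiv_apply_eq {A : Vec5 → Vec5} {x k d : Vec5}
    (hA : ∀ i, DifferentiableAt ℝ (fun y => A y i) x)
    (h : ∀ i, HasDerivAt (fun s : ℝ => A (x + s • k) i) (d i) 0) : fderiv ℝ A x k = d := by
  have h1 := (differentiableAt_pi.2 hA).hasFDerivAt.hasLineDerivAt k
  exact HasDerivAt.unique h1 (hasDerivAt_pi.2 h)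

section line

variable (x k : Vec5)

lemma hasDerivAt_line (a : Fin 5) : HasDerivAt (fun s : ℝ => (x + s • k) a) (k a) 0 := by
  simpa using ((hasDerivAt_id (0 : ℝ)).mul_const (k a)).const_add (x a)

lemma hasDerivAt_line_div (a : Fin 5) {b : Fin 5} (hb : x b ≠ 0) :
    HasDerivAt (fun s : ℝ => (x + s • k) a / (x + s • k) b)
      ((k a * x b - x a * k b) / x b ^ 2) 0 := by
  have := (hasDerivAt_line x k a).fun_div (hasDerivAt_line x k b) (by simpa using hb)
  simpa using this

lemma hasDerivAt_line_sq (a : Fin 5) :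
    HasDerivAt (fun s : ℝ => (x + s • k) a ^ 2) (2 * x a * k a) 0 := by
  simpa using (hasDerivAt_line x k a).fun_pow 2

lemma hasDerivAt_line_sq_div_mul (a : Fin 5) {b c : Fin 5} (hb : x b ≠ 0) (hc : x c ≠ 0) :
    HasDerivAt (fun s : ℝ => (x + s • k) a ^ 2 / ((x + s • k) b * (x + s • k) c))
      ((2 * x a * k a * (x b * x c) - x a ^ 2 * (k b * x c + x b * k c)) / (x b * x c) ^ 2) 0 := by
  have := (hasDerivAt_line_sq x k a).fun_div
    ((hasDerivAt_line x k b).fun_mul (hasDerivAt_line x k c)) (by simpa using ⟨hb, hc⟩)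
  simpa using this

lemma hasDerivAt_line_sq_div_sq (a : Fin 5) {b : Fin 5} (hb : x b ≠ 0) :
    HasDerivAt (fun s : ℝ => (x + s • k) a ^ 2 / (x + s • k) b ^ 2)
      ((2 * x a * k a * x b ^ 2 - x a ^ 2 * (2 * x b * k b)) / (x b ^ 2) ^ 2) 0 := by
  have := (hasDerivAt_line_sq x k a).fun_div (hasDerivAt_line_sq x k b) (by simpa using hb)
  simpa using this

end line

lemma fderiv_coeffAZero {x k : Vec5} (hx : ∀ i, x i ≠ 0) : fderiv ℝ coeffAZero x k =
    ![2 * ((2 * x 0 * k 0 * x 1 ^ 2 - x 0 ^ 2 * (2 * x 1 * k 1)) / (x 1 ^ 2) ^ 2) - 8 * k 0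
        - 12 * ((k 3 * x 4 - x 3 * k 4) / x 4 ^ 2) - 12 * ((k 4 * x 3 - x 4 * k 3) / x 3 ^ 2),
      - (8 * k 1) - 1 / 2 * ((k 0 * x 1 - x 0 * k 1) / x 1 ^ 2)
        - 3 * ((k 2 * x 3 - x 2 * k 3) / x 3 ^ 2) - 3 * ((k 3 * x 2 - x 3 * k 2) / x 2 ^ 2)
        - 3 * ((k 2 * x 4 - x 2 * k 4) / x 4 ^ 2) - 3 * ((k 4 * x 2 - x 4 * k 2) / x 2 ^ 2),
      3 * ((2 * x 2 * k 2 * (x 1 * x 3) - x 2 ^ 2 * (k 1 * x 3 + x 1 * k 3)) / (x 1 * x 3) ^ 2)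
        + 3 * ((2 * x 2 * k 2 * (x 1 * x 4) - x 2 ^ 2 * (k 1 * x 4 + x 1 * k 4)) / (x 1 * x 4) ^ 2)
        - 3 * ((k 3 * x 1 - x 3 * k 1) / x 1 ^ 2) - 3 * ((k 4 * x 1 - x 4 * k 1) / x 1 ^ 2),
      4 * ((2 * x 3 * k 3 * (x 1 * x 2) - x 3 ^ 2 * (k 1 * x 2 + x 1 * k 2)) / (x 1 * x 2) ^ 2)
        + 2 * ((2 * x 3 * k 3 * (x 0 * x 4) - x 3 ^ 2 * (k 0 * x 4 + x 0 * k 4)) / (x 0 * x 4) ^ 2)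
        - 4 * ((k 2 * x 1 - x 2 * k 1) / x 1 ^ 2) - 2 * ((k 4 * x 0 - x 4 * k 0) / x 0 ^ 2),
      4 * ((2 * x 4 * k 4 * (x 1 * x 2) - x 4 ^ 2 * (k 1 * x 2 + x 1 * k 2)) / (x 1 * x 2) ^ 2)
        + 2 * ((2 * x 4 * k 4 * (x 0 * x 3) - x 4 ^ 2 * (k 0 * x 3 + x 0 * k 3)) / (x 0 * x 3) ^ 2)
        - 4 * ((k 2 * x 1 - x 2 * k 1) / x 1 ^ 2) - 2 * ((k 3 * x 0 - x 3 * k 0) / x 0 ^ 2)] := by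
  have hx0 := hx 0
  have hx1 := hx 1
  have hx2 := hx 2
  have hx3 := hx 3
  have hx4 := hx 4
  have D := fun a => hasDerivAt_line x k a
  have D1 := fun a b => hasDerivAt_line_div x k a (hx b)
  have D2 := fun a b c => hasDerivAt_line_sq_div_mul x k a (hx b) (hx c)
  refine fderiv_apply_eq (fun i => ?_) fun i => ?_
  · fin_cases i <;> simp only [coeffAZero, Fin.zero_eta, Fin.mk_one, Fin.reduceFinMk,
      Matrix.cons_val] <;> fun_prop (disch := simp [hx0, hx1, hx2, hx3, hx4])
  · fin_cases i
    · exact (((((hasDerivAt_line_sq_div_sq x k 0 hx1).const_mul 2).const_add 24).sub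
        ((D 0).const_mul 8)).sub ((D1 3 4).const_mul 12)).sub ((D1 4 3).const_mul 12)
    · exact ((((((D 1).const_mul 8).const_sub 32).sub ((D1 0 1).const_mul (1 / 2))).sub
        ((D1 2 3).const_mul 3)).sub ((D1 3 2).const_mul 3)).sub ((D1 2 4).const_mul 3)
        |>.sub ((D1 4 2).const_mul 3)
    · exact ((((D2 2 1 3).const_mul 3).add ((D2 2 1 4).const_mul 3)).sub
        ((D1 3 1).const_mul 3)).sub ((D1 4 1).const_mul 3)
    · exact ((((D2 3 1 2).const_mul 4).add ((D2 3 0 4).const_mul 2)).sub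
        ((D1 2 1).const_mul 4)).sub ((D1 4 0).const_mul 2)
    · exact ((((D2 4 1 2).const_mul 4).add ((D2 4 0 3).const_mul 2)).sub
        ((D1 2 1).const_mul 4)).sub ((D1 3 0).const_mul 2)

lemma fderiv_coeffAOne {x k : Vec5} (hx : ∀ i, x i ≠ 0) : fderiv ℝ coeffAOne x k =
    ![12 * ((2 * x 0 * k 0 * (x 3 * x 4) - x 0 ^ 2 * (k 3 * x 4 + x 3 * k 4)) / (x 3 * x 4) ^ 2)
        - 12 * ((k 4 * x 3 - x 4 * k 3) / x 3 ^ 2),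
      3 * ((2 * x 1 * k 1 * (x 2 * x 3) - x 1 ^ 2 * (k 2 * x 3 + x 2 * k 3)) / (x 2 * x 3) ^ 2)
        - 3 * ((k 2 * x 3 - x 2 * k 3) / x 3 ^ 2),
      3 * ((2 * x 2 * k 2 * (x 1 * x 3) - x 2 ^ 2 * (k 1 * x 3 + x 1 * k 3)) / (x 1 * x 3) ^ 2)
        - 3 * ((k 1 * x 3 - x 1 * k 3) / x 3 ^ 2),
      - (5 * k 3) - 4 * ((k 1 * x 2 - x 1 * k 2) / x 2 ^ 2)
        - 4 * ((k 2 * x 1 - x 2 * k 1) / x 1 ^ 2) - 2 * ((k 0 * x 4 - x 0 * k 4) / x 4 ^ 2)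
        - 2 * ((k 4 * x 0 - x 4 * k 0) / x 0 ^ 2),
      2 * ((2 * x 4 * k 4 * (x 0 * x 3) - x 4 ^ 2 * (k 0 * x 3 + x 0 * k 3)) / (x 0 * x 3) ^ 2)
        - 2 * ((k 0 * x 3 - x 0 * k 3) / x 3 ^ 2)] := by
  have hx0 := hx 0
  have hx1 := hx 1
  have hx2 := hx 2
  have hx3 := hx 3
  have hx4 := hx 4
  have D := fun a => hasDerivAt_line x k a
  have D1 := fun a b => hasDerivAt_line_div x k a (hx b)
  have D2 := fun a b c => hasDerivAt_line_sq_div_mul x k a (hx b) (hx c)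
  refine fderiv_apply_eq (fun i => ?_) fun i => ?_
  · fin_cases i <;> simp only [coeffAOne, Fin.zero_eta, Fin.mk_one, Fin.reduceFinMk,
      Matrix.cons_val] <;> fun_prop (disch := simp [hx0, hx1, hx2, hx3, hx4])
  · fin_cases i
    · exact ((D2 0 3 4).const_mul 12).sub ((D1 4 3).const_mul 12)
    · exact ((D2 1 2 3).const_mul 3).sub ((D1 2 3).const_mul 3)
    · exact ((D2 2 1 3).const_mul 3).sub ((D1 1 3).const_mul 3)
    · exact (((((D 3).const_mul 5).const_sub 32).sub ((D1 1 2).const_mul 4)).sub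
        ((D1 2 1).const_mul 4)).sub ((D1 0 4).const_mul 2) |>.sub ((D1 4 0).const_mul 2)
    · exact ((D2 4 0 3).const_mul 2).sub ((D1 0 3).const_mul 2)

lemma fderiv_of_isLinearMap {B : Vec5 → Vec5} (hB : IsLinearMap ℝ B) (y k : Vec5) :
    fderiv ℝ B y k = B k := by
  have := (LinearMap.toContinuousLinearMap (hB.mk' B)).fderiv (x := y)
  exact congrArg (fun L : Vec5 →L[ℝ] Vec5 => L k) this

lemma fderiv_coeffBZero (x y k : Vec5) : fderiv ℝ (coeffBZero x) y k = coeffBZero x k :=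
  fderiv_of_isLinearMap ⟨fun v w => by
    funext i
    fin_cases i <;> simp [coeffBZero] <;> ring, fun c v => by
    funext i
    fin_cases i <;> simp [coeffBZero] <;> ring⟩ y k

lemma fderiv_coeffBOne (x y k : Vec5) : fderiv ℝ (coeffBOne x) y k = coeffBOne x k :=
  fderiv_of_isLinearMap ⟨fun v w => by
    funext i
    fin_cases i <;> simp [coeffBOne] <;> ring, fun c v => by
    funext i
    fin_cases i <;> simp [coeffBOne] <;> ring⟩ y k

/-- The change of variables from second order terms of `x` to those of the logarithms. -/
def logScale (c k : Vec5) : Vec5 := fun i => k i / (2 * c i ^ 2)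

/-- If `x_i = c_i ^ 2 + t ^ 2 k_i / 2 + o(t ^ 2)` then `φ_i''(0) = k_i / (2 c_i ^ 2)`, which is
`logScale`. The two operators linearize the same equations in these two coordinates. -/
lemma recursionOp_zero (lam : ℝ) {ζ : ℝ} (hζ : 0 < ζ) (k : Vec5) (i : Fin 5) :
    recursionOp coeffAZero coeffBZero (xInitE ζ) 0 k i = 2 * leadZero ζ i ^ 2 *
      (singularSystem lam epsZero (leadZero ζ)).indicial 2 (logScale (leadZero ζ) k) i := by
  have hx : ∀ i, xInitE ζ i ≠ 0 := fun i => by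
    fin_cases i <;> simp [xInitE, hζ.ne']
  have h2 : Real.sqrt 2 ^ 2 = 2 := Real.sq_sqrt (by norm_num)
  rw [indicial_zero lam hζ]
  simp only [recursionOp, _root_.sub_apply, _root_.smul_apply,
    ContinuousLinearMap.id_apply, Pi.sub_apply, Pi.smul_apply, fderiv_coeffAZero hx,
    fderiv_coeffBZero]
  fin_cases i <;> simp [xInitE, coeffBZero, logScale, leadZero, h2] <;> field_simp <;> ring

lemma recursionOp_one (lam : ℝ) {ζ ξ : ℝ} (hζ : 0 < ζ) (hξ : 0 < ξ) (k : Vec5) (i : Fin 5) :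
    recursionOp coeffAOne coeffBOne (xFinalE ζ ξ) 0 k i = 2 * leadOne ζ ξ i ^ 2 *
      (singularSystem lam epsOne (leadOne ζ ξ)).indicial 2 (logScale (leadOne ζ ξ) k) i := by
  have hx : ∀ i, xFinalE ζ ξ i ≠ 0 := fun i => by
    fin_cases i <;> simp [xFinalE, hζ.ne', hξ.ne']
  rw [indicial_one lam hζ hξ]
  simp only [recursionOp, _root_.sub_apply, _root_.smul_apply,
    ContinuousLinearMap.id_apply, Pi.sub_apply, Pi.smul_apply, fderiv_coeffAOne hx,
    fderiv_coeffBOne]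
  fin_cases i <;> simp [xFinalE, coeffBOne, logScale, leadOne] <;> field_simp <;> ring

/-! ### Particular solutions and kernels in order two -/

lemma indicial_particularZero (lam : ℝ) {ζ : ℝ} (hζ : 0 < ζ) :
    (singularSystem lam epsZero (leadZero ζ)).indicial 2
      (logScale (leadZero ζ) (particularZero lam ζ)) =
      (singularSystem lam epsZero (leadZero ζ)).source := by
  have h2 : Real.sqrt 2 ^ 2 = 2 := Real.sq_sqrt (by norm_num)
  rw [indicial_zero lam hζ, source_zero lam hζ]
  funext i
  fin_cases i <;> simp [logScale, leadZero, particularZero] <;> field_simp <;> ring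

/-- A particular solution at `t = 1`, in logarithmic variables. -/
def particularLogOne (lam ζ ξ : ℝ) : Vec5 :=
  ![24 / ζ ^ 2 + 4 * (ζ ^ 2 / ξ ^ 4) - lam,
    (32 / ξ ^ 2 - 7 / 2 * (ζ ^ 2 / ξ ^ 4) - lam) / 7,
    (32 / ξ ^ 2 - 7 / 2 * (ζ ^ 2 / ξ ^ 4) - lam) / 7,
    (- lam - (24 / ζ ^ 2 + 4 * (ζ ^ 2 / ξ ^ 4) - lam) -
      16 / 7 * (32 / ξ ^ 2 - 7 / 2 * (ζ ^ 2 / ξ ^ 4) - lam)) / 18, 0]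

/-- For `m = 2` the first and last rows of the operator are both `v 0 + 6 * v 4`, and the
corresponding source entries agree. The system is thus solvable with `v 4` free, here set to zero.
-/
lemma indicial_particularLogOne (lam : ℝ) {ζ ξ : ℝ} (hζ : 0 < ζ) (hξ : 0 < ξ) :
    (singularSystem lam epsOne (leadOne ζ ξ)).indicial 2 (particularLogOne lam ζ ξ) =
      (singularSystem lam epsOne (leadOne ζ ξ)).source := by
  rw [indicial_one lam hζ hξ, source_one lam hζ hξ]
  funext i
  fin_cases i <;> simp [particularLogOne] <;> ring

lemma leadZero_pos {ζ : ℝ} (hζ : 0 < ζ) (i : Fin 5) : 0 < leadZero ζ i := by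
  fin_cases i <;> simp [leadZero, hζ]

lemma leadOne_pos {ζ ξ : ℝ} (hζ : 0 < ζ) (hξ : 0 < ξ) (i : Fin 5) : 0 < leadOne ζ ξ i := by
  fin_cases i <;> simp [leadOne, hζ, hξ]

lemma mem_kernelZero_iff (lam : ℝ) {ζ : ℝ} (hζ : 0 < ζ) (k : Vec5) :
    k ∈ kernelZero ζ ↔ (singularSystem lam epsZero (leadZero ζ)).indicial 2
      (logScale (leadZero ζ) k) = 0 := by
  rw [kernelZero, LinearMap.mem_ker]
  change recursionOp _ _ _ _ k = 0 ↔ _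
  simp only [funext_iff, recursionOp_zero lam hζ, Pi.zero_apply]
  refine forall_congr' fun i => ?_
  have := leadZero_pos hζ i
  exact mul_eq_zero_iff_left (by positivity)

lemma mem_kernelOne_iff (lam : ℝ) {ζ ξ : ℝ} (hζ : 0 < ζ) (hξ : 0 < ξ) (k : Vec5) :
    k ∈ kernelOne ζ ξ ↔ (singularSystem lam epsOne (leadOne ζ ξ)).indicial 2
      (logScale (leadOne ζ ξ) k) = 0 := by
  rw [kernelOne, LinearMap.mem_ker]
  change recursionOp _ _ _ _ k = 0 ↔ _
  simp only [funext_iff, recursionOp_one lam hζ hξ, Pi.zero_apply]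
  refine forall_congr' fun i => ?_
  have := leadOne_pos hζ hξ i
  exact mul_eq_zero_iff_left (by positivity)

lemma kernelZero_eq_span {ζ : ℝ} (hζ : 0 < ζ) :
    kernelZero ζ = Submodule.span ℝ (Set.range ![(![-64, 1, 0, 0, 0] : Vec5), ![0, 0, -3, 2, 2]]) := by
  have h2 : Real.sqrt 2 ^ 2 = 2 := Real.sq_sqrt (by norm_num)
  ext k
  -- The indicial operator does not depend on `lam`, so any value serves. Its rows 0 and 1 coincide
  -- for `m = 2`, hence only row 0 is used below.
  rw [mem_kernelZero_iff 0 hζ, indicial_zero 0 hζ, Matrix.range_cons, Matrix.range_cons,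
    Matrix.range_empty, Set.union_empty, Set.singleton_union, Submodule.mem_span_pair]
  constructor
  · intro h
    have h0 := congrFun h 0
    have h2' := congrFun h 2
    have h3 := congrFun h 3
    have h4 := congrFun h 4
    simp [logScale, leadZero, h2] at h0 h2' h3 h4
    field_simp at h0 h2' h3 h4
    have e1 : k 3 = k 4 := by linarith
    have e2 : k 2 = -3 / 2 * k 3 := by linarith
    -- The contribution of the last three coordinates to row 0 cancels, since `8 * (-3) + 6 * 2 + 6
    -- * 2 = 0`.
    rw [e2, ← e1] at h0
    have e0 : k 0 = -64 * k 1 := by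
      refine mul_left_cancel₀ (pow_ne_zero 2 hζ.ne') ?_
      linear_combination h0 / 6
    refine ⟨k 1, k 3 / 2, ?_⟩
    funext i
    fin_cases i <;> simp [e0, e2, ← e1] <;> ring
  · rintro ⟨a, b, rfl⟩
    funext i
    fin_cases i <;> simp [logScale, leadZero, h2] <;> field_simp <;> ring

lemma finrank_kernelZero {ζ : ℝ} (hζ : 0 < ζ) : Module.finrank ℝ (kernelZero ζ) = 2 := by
  rw [kernelZero_eq_span hζ, finrank_span_eq_card, Fintype.card_fin]
  refine LinearIndependent.pair_iff.2 fun s t h => ?_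
  have h1 := congrFun h 1
  have h3 := congrFun h 3
  simp at h1 h3
  exact ⟨h1, h3⟩

lemma kernelOne_eq_span {ζ ξ : ℝ} (hζ : 0 < ζ) (hξ : 0 < ξ) :
    kernelOne ζ ξ = Submodule.span ℝ {(![-6, 0, 0, 0, 1] : Vec5)} := by
  ext k
  rw [mem_kernelOne_iff 0 hζ hξ, indicial_one 0 hζ hξ, Submodule.mem_span_singleton]
  constructor
  · intro h
    have h0 := congrFun h 0
    have h1 := congrFun h 1
    have h2 := congrFun h 2
    have h3 := congrFun h 3
    simp [logScale, leadOne] at h0 h1 h2 h3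
    field_simp at h0 h1 h2 h3
    have e1 : k 1 = 0 := by linarith
    have e2 : k 2 = 0 := by linarith
    have e0 : k 0 = -6 * k 4 := by linarith
    rw [e0, e1, e2] at h3
    have e3 : k 3 = 0 := by
      have : ζ ^ 2 * ξ ^ 2 * k 3 = 0 := by linear_combination h3 / 18
      exact (mul_eq_zero.1 this).resolve_left (by positivity)
    refine ⟨k 4, ?_⟩
    funext i
    fin_cases i <;> simp [e0, e1, e2, e3]
    ring
  · rintro ⟨a, rfl⟩
    funext i
    fin_cases i <;> simp [logScale, leadOne] <;> field_simp <;> ring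

lemma finrank_kernelOne {ζ ξ : ℝ} (hζ : 0 < ζ) (hξ : 0 < ξ) :
    Module.finrank ℝ (kernelOne ζ ξ) = 1 := by
  rw [kernelOne_eq_span hζ hξ]
  refine finrank_span_singleton fun h => ?_
  have := congrFun h 4
  simp at this

/-! ### Germs of solutions, analytic extension and time reversal -/

lemma einsteinE_neg {lam : ℝ} {u v w : Vec5} (h : EinsteinE lam u v w) :
    EinsteinE lam u (-v) w := by
  rw [einsteinE_iff] at h ⊢
  intro i
  rw [← h i]
  simp [neg_div, Finset.sum_neg_distrib]

lemma derivWithin_eq_of_eventuallyEq {f g : ℝ → Vec5} {s : Set ℝ} {a : ℝ} (hs : UniqueDiffOn ℝ s)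
    (ha : a ∈ s) (hg : AnalyticAt ℝ g a) (e : f =ᶠ[𝓝[s] a] g) :
    derivWithin f s a = deriv g a ∧ iteratedDerivWithin 2 f s a = deriv (deriv g) a := by
  constructor
  · rw [e.derivWithin_eq_of_mem ha, hg.differentiableAt.derivWithin (hs a ha)]
  · rw [e.iteratedDerivWithin_eq (e.self_of_nhdsWithin ha),
      iteratedDerivWithin_eq_iteratedDeriv hs hg.contDiffAt ha, iteratedDeriv_succ,
      iteratedDeriv_one]

lemma exists_analytic_extension {f : ℝ → Vec5} {s : Set ℝ} {a : ℝ} (ha : a ∈ s)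
    (hf : AnalyticOn ℝ f s) : ∃ g, AnalyticAt ℝ g a ∧ f =ᶠ[𝓝[s] a] g := by
  obtain ⟨g, e, hg⟩ := analyticWithinAt_iff_exists_analyticAt.1 (hf a ha)
  rw [insert_eq_of_mem ha] at e
  exact ⟨g, hg, e⟩

lemma IsSmoothSolution.eventually_pos {lam : ℝ} {ε : Fin 5 → ℕ} {c : Vec5} {g : ℝ → Vec5}
    (hε : ∀ i, ε i = 0 ∨ ε i = 1) (hε' : ∀ a, 0 ≤ 2 + ∑ j, ε j * expo a j)
    (hc : ∀ i, 0 < c i) (hg : IsSmoothSolution lam ε c g) : ∀ᶠ t in 𝓝[>] 0, ∀ i, 0 < g t i := by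
  obtain ⟨φ, -, -, e⟩ := hg.exists_log hε hε' hc
  filter_upwards [e.filter_mono nhdsWithin_le_nhds, self_mem_nhdsWithin] with t ht ht0 i
  have : 0 < t := ht0
  rw [ht, ofLog]
  positivity

/-- A smooth solution, restricted to an interval adjacent to the singular orbit. -/
lemma IsSmoothSolution.exists_Ico {lam : ℝ} {ε : Fin 5 → ℕ} {c : Vec5} {g : ℝ → Vec5}
    (hε : ∀ i, ε i = 0 ∨ ε i = 1) (hε' : ∀ a, 0 ≤ 2 + ∑ j, ε j * expo a j)
    (hc : ∀ i, 0 < c i) (hg : IsSmoothSolution lam ε c g) : ∃ r > 0,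
      (∀ t ∈ Ico 0 r, AnalyticAt ℝ g t) ∧ ∀ t ∈ Ioo 0 r, (∀ i, 0 < g t i) ∧
        EinsteinE lam (g t) (deriv g t) (deriv (deriv g) t) := by
  obtain ⟨r₁, h₁, H₁⟩ := mem_nhdsGT_iff_exists_Ioo_subset.1
    ((hg.eventually_pos hε hε' hc).and hg.einstein)
  obtain ⟨r₂, h₂, H₂⟩ := Metric.eventually_nhds_iff.1 hg.analyticAt.eventually_analyticAt
  refine ⟨min r₁ r₂, lt_min h₁ h₂, fun t ht => H₂ ?_, fun t ht =>
    H₁ ⟨ht.1, ht.2.trans_le (min_le_left _ _)⟩⟩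
  rw [Real.dist_eq, sub_zero, abs_of_nonneg ht.1]
  exact ht.2.trans_le (min_le_right _ _)

lemma epsZero_spec : (∀ i, epsZero i = 0 ∨ epsZero i = 1) ∧
    (∀ a, 0 ≤ 2 + ∑ j, (epsZero j : ℤ) * expo a j) ∧
    ∀ a, 2 + ∑ j, (epsZero j : ℤ) * expo a j ≠ 1 := by
  decide

lemma epsOne_spec : (∀ i, epsOne i = 0 ∨ epsOne i = 1) ∧
    (∀ a, 0 ≤ 2 + ∑ j, (epsOne j : ℤ) * expo a j) ∧
    ∀ a, 2 + ∑ j, (epsOne j : ℤ) * expo a j ≠ 1 := by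
  decide

/-- A function analytic up to the closed end agrees on its interval with one analytic in a full
neighbourhood of 0, and one-sided derivatives become ordinary ones. -/
lemma mem_initialGermsE_iff {lam ζ : ℝ} (hζ : 0 < ζ) (γ : Germ (𝓝[≥] (0 : ℝ)) Vec5) :
    γ ∈ initialGermsE lam ζ ↔
      ∃ g : ℝ → Vec5, IsSmoothSolution lam epsZero (leadZero ζ) g ∧ (g : Germ _ Vec5) = γ := by
  constructor
  · rintro ⟨r, hr, f, ⟨hf, hE⟩, ⟨i0, i1, i2, i3⟩, rfl⟩
    have h0 : (0 : ℝ) ∈ Ico 0 r := ⟨le_rfl, hr⟩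
    obtain ⟨g, hg, e⟩ := exists_analytic_extension h0 hf
    obtain ⟨d1, d2⟩ := derivWithin_eq_of_eventuallyEq (uniqueDiffOn_Ico 0 r) h0 hg e
    rw [d1] at i1
    rw [d2] at i2 i3
    have e0 := e.self_of_nhdsWithin h0
    rw [nhdsWithin_Ico_eq_nhdsGE hr] at e
    refine ⟨g, ⟨hg, ?_, fun i => ?_, fun i => ?_, fun i hi => ?_⟩, Germ.coe_eq.2 e.symm⟩
    -- Agreement near each `t > 0`, not merely at `t`, is needed to transfer derivatives.
    · have e' : ∀ᶠ t in 𝓝[>] (0 : ℝ), f =ᶠ[𝓝 t] g := by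
        have := eventually_eventually_nhdsWithin.2 (e.filter_mono (nhdsWithin_mono 0 Ioi_subset_Ici_self))
        filter_upwards [this, self_mem_nhdsWithin] with t ht ht0
        rwa [nhdsWithin_eq_nhds.2 (Ioi_mem_nhds ht0)] at ht
      filter_upwards [e', Ioo_mem_nhdsGT hr] with t ht ht0
      have := (hE t (by rwa [interior_Ico])).2
      rwa [ht.self_of_nhds, ht.deriv_eq, ht.deriv.deriv_eq] at this
    · rw [← e0, i0]
      fin_cases i <;> simp [epsZero, leadZero]
    · rw [i1]
      fin_cases i <;> simp [epsZero, leadZero]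
    · fin_cases i
      · exact i2
      · exact i3
      all_goals simp [epsZero] at hi
  · rintro ⟨g, hg, rfl⟩
    obtain ⟨r, hr, han, hE⟩ := hg.exists_Ico epsZero_spec.1 epsZero_spec.2.1 (leadZero_pos hζ)
    have h0 : (0 : ℝ) ∈ Ico 0 r := ⟨le_rfl, hr⟩
    obtain ⟨d1, d2⟩ := derivWithin_eq_of_eventuallyEq (uniqueDiffOn_Ico 0 r) h0 hg.analyticAt
      EventuallyEq.rfl
    refine ⟨r, hr, g, ⟨fun t ht => (han t ht).analyticWithinAt, ?_⟩, ⟨?_, ?_, ?_, ?_⟩, rfl⟩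
    · rw [interior_Ico]
      exact hE
    · funext i
      rw [hg.value]
      fin_cases i <;> simp [epsZero, leadZero]
    · funext i
      rw [d1, hg.slope]
      fin_cases i <;> simp [epsZero, leadZero]
    · rw [d2]
      exact hg.second 0 (by decide)
    · rw [d2]
      exact hg.second 1 (by decide)

/-- Reversal of time, exchanging `t = 0` and `t = 1`. -/
def reflect (f : ℝ → Vec5) (t : ℝ) : Vec5 := f (1 - t)

lemma reflect_reflect (f : ℝ → Vec5) : reflect (reflect f) = f := by
  funext t
  simp [reflect]

lemma deriv_reflect (f : ℝ → Vec5) (t : ℝ) : deriv (reflect f) t = -deriv f (1 - t) :=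
  deriv_comp_const_sub ..

lemma deriv_deriv_reflect (f : ℝ → Vec5) (t : ℝ) :
    deriv (deriv (reflect f)) t = deriv (deriv f) (1 - t) := by
  have : deriv (reflect f) = fun s => -reflect (deriv f) s := funext fun s => deriv_reflect f s
  rw [this, deriv.fun_neg, deriv_reflect, neg_neg]

lemma analyticAt_reflect {f : ℝ → Vec5} {t : ℝ} (hf : AnalyticAt ℝ f (1 - t)) :
    AnalyticAt ℝ (reflect f) t :=
  hf.comp_of_eq (analyticAt_const.sub analyticAt_id) rfl

lemma tendsto_one_sub {s u : Set ℝ} {a : ℝ} (h : ∀ t ∈ s, 1 - t ∈ u) :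
    Tendsto (fun t : ℝ => 1 - t) (𝓝[s] a) (𝓝[u] (1 - a)) :=
  ((continuous_const.sub continuous_id).continuousWithinAt).tendsto_nhdsWithin h

lemma tendsto_one_sub_LE : Tendsto (fun t : ℝ => 1 - t) (𝓝[≤] 1) (𝓝[≥] 0) := by
  simpa using tendsto_one_sub (s := Iic 1) (u := Ici 0) (a := 1) (by simp)

lemma tendsto_one_sub_GT : Tendsto (fun t : ℝ => 1 - t) (𝓝[>] 0) (𝓝[<] 1) := by
  simpa using tendsto_one_sub (s := Ioi 0) (u := Iio 1) (a := 0) (by simp)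

lemma tendsto_one_sub_LT : Tendsto (fun t : ℝ => 1 - t) (𝓝[<] 1) (𝓝[>] 0) := by
  simpa using tendsto_one_sub (s := Iio 1) (u := Ioi 0) (a := 1) (by simp)

/-- Under `t ↦ 1 - t` first derivatives change sign, which the system does not see, since they enter
only in products of two. The slope `-2` becomes the positive leading coefficient 2. -/
lemma mem_finalGermsE_iff {lam ζ ξ : ℝ} (hζ : 0 < ζ) (hξ : 0 < ξ)
    (γ : Germ (𝓝[≤] (1 : ℝ)) Vec5) :
    γ ∈ finalGermsE lam ζ ξ ↔ ∃ g : ℝ → Vec5,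
      IsSmoothSolution lam epsOne (leadOne ζ ξ) g ∧ (reflect g : Germ _ Vec5) = γ := by
  constructor
  · rintro ⟨r, hr, f, ⟨hf, hE⟩, ⟨i0, i1, i2⟩, rfl⟩
    have hr' : 1 - r < 1 := by linarith
    have h1 : (1 : ℝ) ∈ Ioc (1 - r) 1 := ⟨hr', le_rfl⟩
    obtain ⟨g, hg, e⟩ := exists_analytic_extension h1 hf
    obtain ⟨d1, d2⟩ := derivWithin_eq_of_eventuallyEq (uniqueDiffOn_Ioc (1 - r) 1) h1 hg e
    rw [d1] at i1
    rw [d2] at i2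
    have e0 := e.self_of_nhdsWithin h1
    rw [nhdsWithin_Ioc_eq_nhdsLE hr'] at e
    refine ⟨reflect g, ⟨analyticAt_reflect (by simpa using hg), ?_, fun i => ?_, fun i => ?_,
      fun i hi => ?_⟩, ?_⟩
    · have e' : ∀ᶠ t in 𝓝[<] (1 : ℝ), f =ᶠ[𝓝 t] g := by
        have := eventually_eventually_nhdsWithin.2 (e.filter_mono (nhdsWithin_mono 1 Iio_subset_Iic_self))
        filter_upwards [this, self_mem_nhdsWithin] with t ht ht0
        rwa [nhdsWithin_eq_nhds.2 (Iio_mem_nhds ht0)] at ht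
      filter_upwards [tendsto_one_sub_GT.eventually (e'.and (Ioo_mem_nhdsLT hr'))]
        with t ⟨ht, ht0⟩
      have := (hE (1 - t) (by rwa [interior_Ioc])).2
      rw [ht.self_of_nhds, ht.deriv_eq, ht.deriv.deriv_eq] at this
      rw [deriv_reflect, deriv_deriv_reflect]
      exact einsteinE_neg this
    · rw [reflect, sub_zero, ← e0, i0]
      fin_cases i <;> simp [epsOne, leadOne]
    · rw [deriv_reflect, sub_zero, i1]
      fin_cases i <;> simp [epsOne, leadOne]
    · rw [deriv_deriv_reflect, sub_zero]
      have : i = 3 := by revert i; decide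
      rw [this]
      exact i2
    · rw [reflect_reflect]
      exact Germ.coe_eq.2 e.symm
  · rintro ⟨g, hg, rfl⟩
    obtain ⟨r, hr, han, hE⟩ := hg.exists_Ico epsOne_spec.1 epsOne_spec.2.1 (leadOne_pos hζ hξ)
    have hr' : 1 - r < 1 := by linarith
    have h1 : (1 : ℝ) ∈ Ioc (1 - r) 1 := ⟨hr', le_rfl⟩
    have han' : ∀ t ∈ Ioc (1 - r) 1, AnalyticAt ℝ (reflect g) t := fun t ht =>
      analyticAt_reflect (han _ ⟨by linarith [ht.2], by linarith [ht.1]⟩)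
    obtain ⟨d1, d2⟩ := derivWithin_eq_of_eventuallyEq (uniqueDiffOn_Ioc (1 - r) 1) h1 (han' 1 h1)
      EventuallyEq.rfl
    refine ⟨r, hr, reflect g, ⟨fun t ht => (han' t ht).analyticWithinAt, ?_⟩, ⟨?_, ?_, ?_⟩, rfl⟩
    · rw [interior_Ioc]
      intro t ht
      have := hE (1 - t) ⟨by linarith [ht.2], by linarith [ht.1]⟩
      refine ⟨this.1, ?_⟩
      rw [deriv_reflect, deriv_deriv_reflect]
      exact einsteinE_neg this.2
    · funext i
      rw [reflect, sub_self, hg.value]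
      fin_cases i <;> simp [epsOne, leadOne]
    · funext i
      rw [d1, deriv_reflect, sub_self, Pi.neg_apply, hg.slope]
      fin_cases i <;> simp [epsOne, leadOne]
    · rw [d2, deriv_deriv_reflect, sub_self]
      exact hg.second 3 (by decide)

/-! ### Parametrization of the solutions by the kernel of `𝓛₀` -/

/-- The parametrization of the smooth solutions by a subspace of second order terms of `x`. -/
theorem exists_parametrization {lam : ℝ} {ε : Fin 5 → ℕ} {c : Vec5}
    (hε : (∀ i, ε i = 0 ∨ ε i = 1) ∧ (∀ a, 0 ≤ 2 + ∑ j, (ε j : ℤ) * expo a j) ∧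
      ∀ a, 2 + ∑ j, (ε j : ℤ) * expo a j ≠ 1) (hc : ∀ i, 0 < c i)
    (hS : (singularSystem lam ε c).Balanced)
    (hT : ∀ m ≥ 3, ∀ v, (singularSystem lam ε c).indicial m v = 0 → v = 0)
    {K : Submodule ℝ Vec5} {p : Vec5}
    (hK : ∀ k, k ∈ K ↔ (singularSystem lam ε c).indicial 2 (logScale c k) = 0)
    (hp : (singularSystem lam ε c).indicial 2 (logScale c p) = (singularSystem lam ε c).source) :
    ∃ G : K → ℝ → Vec5, (∀ k, IsSmoothSolution lam ε c (G k)) ∧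
      (∀ k, HasSecondOrder ε c (G k) (logScale c (p + k))) ∧
      (∀ k k', G k =ᶠ[𝓝[>] 0] G k' → k = k') ∧
      ∀ g, IsSmoothSolution lam ε c g → ∃ k, g =ᶠ[𝓝 0] G k := by
  obtain ⟨G, h1, h2, h3⟩ := exists_family hε.1 hε.2.1 hε.2.2 hc hS hT
  have hadd : ∀ k k' : Vec5, logScale c (k + k') = logScale c k + logScale c k' := fun k k' => by
    funext i
    simp [logScale, add_div]
  have hinj : Function.Injective (logScale c) := fun k k' h => by
    funext i
    have hi := hc i
    exact (div_left_inj' (by positivity)).1 (congrFun h i)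
  have hQ : ∀ k : K, (singularSystem lam ε c).indicial 2 (logScale c (p + k)) =
      (singularSystem lam ε c).source := fun k => by
    rw [hadd, map_add, hp, (hK k).1 k.2, add_zero]
  refine ⟨fun k => G ⟨_, hQ k⟩, fun k => h1 _, fun k => h2 _, fun k k' e => ?_, fun g hg => ?_⟩
  -- Equal germs have equal second-order terms, and these determine `k`.
  · have := hinj (((h2 ⟨_, hQ k⟩).congr e).unique hc (h2 ⟨_, hQ k'⟩))
    exact Subtype.ext (add_left_cancel this)
  · obtain ⟨q, hq⟩ := h3 g hg
    -- The witness undoes `logScale` on the second-order datum `q` and subtracts the particular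
    -- solution.
    set k : Vec5 := (fun i => 2 * c i ^ 2 * q.1 i) - p with hk
    have hkq : logScale c (p + k) = q.1 := by
      funext i
      have := (hc i).ne'
      simp only [hk, logScale, add_sub_cancel]
      field_simp
    have hkK : k ∈ K := by
      rw [hK]
      have := q.2
      rw [← hkq, hadd, map_add, hp] at this
      exact add_eq_left.1 this
    refine ⟨⟨k, hkK⟩, ?_⟩
    have : q = ⟨_, hQ ⟨k, hkK⟩⟩ := Subtype.ext hkq.symm
    rwa [this] at hq

lemma infinite_of_equiv {X : Type*} {K : Submodule ℝ Vec5} {s : Set X}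
    (hK : 0 < Module.finrank ℝ K) (Φ : K ≃ s) : s.Infinite := by
  have : Nontrivial K := Module.nontrivial_of_finrank_pos hK
  have : Infinite K := Module.Free.infinite ℝ K
  exact Set.infinite_coe_iff.1 (Φ.infinite_iff.1 this)

theorem initial_parametrization (lam : ℝ) {ζ : ℝ} (hζ : 0 < ζ) :
    ∃ Φ : kernelZero ζ ≃ initialGermsE lam ζ, ∀ (k : kernelZero ζ) (f : ℝ → Vec5),
      (f : Germ (𝓝[≥] (0 : ℝ)) Vec5) = (Φ k).1 →
      (fun t : ℝ => xVarZero f t - xInitE ζ - (t ^ 2 / 2) • (particularZero lam ζ + (k : Vec5)))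
        =o[𝓝[>] (0 : ℝ)] fun t : ℝ => t ^ 2 := by
  obtain ⟨G, h1, h2, h3, h4⟩ := exists_parametrization epsZero_spec (leadZero_pos hζ)
    (balanced_zero lam hζ) (fun m hm v hv => eq_zero_of_indicial_zero lam hζ hm hv)
    (mem_kernelZero_iff lam hζ) (indicial_particularZero lam hζ)
  have hgt : 𝓝[>] (0 : ℝ) ≤ 𝓝[≥] 0 := nhdsWithin_mono 0 Ioi_subset_Ici_self
  let F : kernelZero ζ → initialGermsE lam ζ := fun k =>
    ⟨(G k : Germ _ Vec5), (mem_initialGermsE_iff hζ _).2 ⟨G k, h1 k, rfl⟩⟩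
  have hF : Function.Bijective F := by
    refine ⟨fun k k' h => h3 k k' ?_, fun ⟨γ, hγ⟩ => ?_⟩
    · exact (Germ.coe_eq.1 (congrArg Subtype.val h)).filter_mono hgt
    · obtain ⟨g, hg, rfl⟩ := (mem_initialGermsE_iff hζ _).1 hγ
      obtain ⟨k, hk⟩ := h4 g hg
      exact ⟨k, Subtype.ext (Germ.coe_eq.2 (hk.symm.filter_mono nhdsWithin_le_nhds))⟩
  refine ⟨Equiv.ofBijective F hF, fun k f hf => isLittleO_pi.2 fun i => ?_⟩
  have e : f =ᶠ[𝓝[≥] 0] G k := Germ.coe_eq.1 hf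
  have hs : Real.sqrt 2 ^ 2 = 2 := Real.sq_sqrt (by norm_num)
  refine ((h2 k).congr (e.filter_mono hgt).symm i).congr_left fun t => ?_
  have hi := (leadZero_pos hζ i).ne'
  have key : t ^ 2 * (leadZero ζ i ^ 2 * logScale (leadZero ζ) (particularZero lam ζ + k) i) =
      t ^ 2 / 2 * (particularZero lam ζ + (k : Vec5)) i := by
    rw [logScale]
    field_simp
  rw [key]
  simp only [Pi.sub_apply, Pi.smul_apply, smul_eq_mul]
  congr 1
  fin_cases i <;> simp [xVarZero, xInitE, epsZero, leadZero, hs]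
  norm_num

theorem final_parametrization (lam : ℝ) {ζ ξ : ℝ} (hζ : 0 < ζ) (hξ : 0 < ξ) :
    ∃ (p : Vec5) (Φ : kernelOne ζ ξ ≃ finalGermsE lam ζ ξ),
      ∀ (k : kernelOne ζ ξ) (f : ℝ → Vec5), (f : Germ (𝓝[≤] (1 : ℝ)) Vec5) = (Φ k).1 →
      (fun t : ℝ => xVarOne f t - xFinalE ζ ξ - ((1 - t) ^ 2 / 2) • (p + (k : Vec5)))
        =o[𝓝[<] (1 : ℝ)] fun t : ℝ => (1 - t) ^ 2 := by
  set c := leadOne ζ ξ with hcdef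
  set p : Vec5 := fun i => 2 * c i ^ 2 * particularLogOne lam ζ ξ i with hpdef
  have hc : ∀ i, 0 < c i := leadOne_pos hζ hξ
  have hp : logScale c p = particularLogOne lam ζ ξ := by
    funext i
    have := (hc i).ne'
    simp only [logScale, hpdef]
    field_simp
  obtain ⟨G, h1, h2, h3, h4⟩ := exists_parametrization epsOne_spec hc
    (balanced_one lam hζ hξ) (fun m hm v hv => eq_zero_of_indicial_one lam hζ hξ hm hv)
    (mem_kernelOne_iff lam hζ hξ) (p := p) (by rw [hp]; exact indicial_particularLogOne lam hζ hξ)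
  have hlt : 𝓝[<] (1 : ℝ) ≤ 𝓝[≤] 1 := nhdsWithin_mono 1 Iio_subset_Iic_self
  let F : kernelOne ζ ξ → finalGermsE lam ζ ξ := fun k =>
    ⟨(reflect (G k) : Germ _ Vec5), (mem_finalGermsE_iff hζ hξ _).2 ⟨G k, h1 k, rfl⟩⟩
  have hF : Function.Bijective F := by
    refine ⟨fun k k' h => h3 k k' ?_, fun ⟨γ, hγ⟩ => ?_⟩
    · have e := (Germ.coe_eq.1 (congrArg Subtype.val h)).filter_mono hlt
      have := e.comp_tendsto tendsto_one_sub_GT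
      simpa [reflect, Function.comp_def] using this
    · obtain ⟨g, hg, rfl⟩ := (mem_finalGermsE_iff hζ hξ _).1 hγ
      obtain ⟨k, hk⟩ := h4 g hg
      exact ⟨k, Subtype.ext (Germ.coe_eq.2
        ((hk.symm.filter_mono nhdsWithin_le_nhds).comp_tendsto tendsto_one_sub_LE))⟩
  refine ⟨p, Equiv.ofBijective F hF, fun k f hf => isLittleO_pi.2 fun i => ?_⟩
  have e : f =ᶠ[𝓝[≤] 1] reflect (G k) := Germ.coe_eq.1 hf
  refine ((h2 k i).comp_tendsto tendsto_one_sub_LT).congr' ?_ EventuallyEq.rfl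
  filter_upwards [e.filter_mono hlt] with t ht
  have hi := (hc i).ne'
  have key : (1 - t) ^ 2 * (c i ^ 2 * logScale c (p + k) i) =
      (1 - t) ^ 2 / 2 * (p + (k : Vec5)) i := by
    rw [logScale]
    field_simp
  simp only [Function.comp_apply, Pi.sub_apply, Pi.smul_apply, smul_eq_mul]
  rw [key]
  congr 1
  have ht' : G k (1 - t) = f t := ht.symm
  rw [ht']
  fin_cases i <;> simp [xVarOne, xFinalE, epsOne, hcdef, leadOne]
  norm_num

end ModelE

end

theorem mainTheorem9 (lam : ℝ) :
    (∀ ζ : ℝ, 0 < ζ →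
      (initialGermsE lam ζ).Infinite ∧
      Module.finrank ℝ (kernelZero ζ) = 2 ∧
      ∃ Φ : kernelZero ζ ≃ initialGermsE lam ζ,
        ∀ (k : kernelZero ζ) (f : ℝ → Vec5),
          (f : Filter.Germ (nhdsWithin (0 : ℝ) (Set.Ici 0)) Vec5) = (Φ k).1 →
          (fun t : ℝ => xVarZero f t - xInitE ζ
              - (t ^ 2 / 2) • (particularZero lam ζ + (k : Vec5)))
            =o[nhdsWithin (0 : ℝ) (Set.Ioi 0)] fun t : ℝ => t ^ 2) ∧
    (∀ ζ ξ : ℝ, 0 < ζ → 0 < ξ →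
      (finalGermsE lam ζ ξ).Infinite ∧
      Module.finrank ℝ (kernelOne ζ ξ) = 1 ∧
      ∃ (p : Vec5) (Φ : kernelOne ζ ξ ≃ finalGermsE lam ζ ξ),
        ∀ (k : kernelOne ζ ξ) (f : ℝ → Vec5),
          (f : Filter.Germ (nhdsWithin (1 : ℝ) (Set.Iic 1)) Vec5) = (Φ k).1 →
          (fun t : ℝ => xVarOne f t - xFinalE ζ ξ
              - ((1 - t) ^ 2 / 2) • (p + (k : Vec5)))
            =o[nhdsWithin (1 : ℝ) (Set.Iio 1)] fun t : ℝ => (1 - t) ^ 2) := by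
  refine ⟨fun ζ hζ => ?_, fun ζ ξ hζ hξ => ?_⟩
  · obtain ⟨Φ, hΦ⟩ := ModelE.initial_parametrization lam hζ
    exact ⟨ModelE.infinite_of_equiv (by rw [ModelE.finrank_kernelZero hζ]; norm_num) Φ,
      ModelE.finrank_kernelZero hζ, Φ, hΦ⟩
  · obtain ⟨p, Φ, hΦ⟩ := ModelE.final_parametrization lam hζ hξ
    exact ⟨ModelE.infinite_of_equiv (by rw [ModelE.finrank_kernelOne hζ hξ]; norm_num) Φ,
      ModelE.finrank_kernelOne hζ hξ, p, Φ, hΦ⟩
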